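/- **Setting.** Let $\rho_0$ be an unknown density operator on $\mathbb C^d$, let $\{P_j\}_{j=1}^M$ be an unknown detector (positive semidefinite matrices with $\sum_jP_j=I$), and let $\mathcal E_a(X)=\sum_{i=1}^{d^2}A_i^aX(A_i^a)^\dagger$, $\sum_i(A_i^a)^\dagger A_i^a\le I$, $a=1,\dots,L$, be known processes; $\mathcal E_a$ is trace preserving (TP) if equality holds. Put $\rho_a=\mathcal E_a(\rho_0)$ and $\mathcal B_a=\sum_i(A_i^a)^*\otimes A_i^a$. $\|\cdot\|$ is the Frobenius norm, and $\operatorname{vec}$ stacks columns. All copies are measured independently according to Born's rule (a copy of $\rho_a$ is lost with probability $1-\operatorname{Tr}\rho_a$), $N_0\ge1$ copies are used in each experiment, and $\mathbb E$ is the expectation over all measurement results. In what follows a quotient with denominator $0$ is read as $0$. **Corrections.** (i) A Hermitian $\bar\rho_0$ of trace one with eigenvalues $\lambda_1\ge\dots\ge\lambda_d$ is replaced by $\hat\rho_0$ with the same eigenvectors and eigenvalues $\mu_i=\lambda_i+\frac1m\sum_{k>m}\lambda_k$ for $i\le m$ and $\mu_i=0$ for $i>m$, where $m$ is the largest index with $\lambda_m+\frac1m\sum_{k>m}\lambda_k\ge0$.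 (ii) Hermitian $\bar P_j$ with positive parts $F_j$ are replaced by $\hat P_j=S^{-1/2}F_jS^{-1/2}$, $S=\sum_jF_j$. If $\bar\rho_0$ does not have trace one, or $S$ is singular, any density operator, respectively any detector, may be returned. **Orthonormal-basis algorithm (Problem 1).** Let $I/\sqrt d,\Omega_1,\dots,\Omega_{d^2-1}$ be a Hermitian orthonormal operator basis with $\operatorname{Tr}\Omega_k=0$, and let every $\mathcal E_a$ be generalized-unital: $\mathcal E_a(I)=\alpha_aI$ with $0<\alpha_a\le1$. Let $x_{0,k}=\operatorname{Tr}(\Omega_k\rho_0)$, $C_{j,k}=\operatorname{Tr}(\Omega_kP_j)$, $C_j=(C_{j,k})_{k\ge1}$, $C_{j,0}=\operatorname{Tr}(P_j)/\sqrt d$, $x_{a,0}=\operatorname{Tr}(\rho_a)/\sqrt d$, let $E_a$ be the real matrix $(\operatorname{Tr}(\Omega_k\mathcal E_a(\Omega_l)))_{k,l\ge1}$ and $B=[\operatorname{vec}(E_1),\dots,\operatorname{vec}(E_L)]^T$. Fix one index $k_0$. 1. From relative frequencies and averages obtain: $\hat y_{aj}$ (estimate of $\operatorname{Tr}(P_j\rho_a)$)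 by applying the detector to $\rho_a$; $\hat x_{a,0}$ by measuring the operator $I$ on $\rho_a$ if $\mathcal E_a$ is not TP, and $\hat x_{a,0}=1/\sqrt d$ otherwise; $\hat C_{j,0}$ by applying the detector to $I/d$; $\bar x_{0,k_0}$ by measuring the observable $\Omega_{k_0}$ on $\rho_0$. Set $\hat Y_{aj}=\hat y_{aj}-\hat x_{a,0}\hat C_{j,0}$, $\hat Y_j=(\hat Y_{aj})_a$. 2. $\hat z_j=(B^TB)^{-1}B^T\hat Y_j$. 3. For each $j$ let $\tilde x^{(j)}\tilde C_j^T$ be the term of a largest singular value in a singular value decomposition of the matrix whose rows are the consecutive blocks of length $d^2-1$ of $\hat z_j$; put $\bar x_0^{(j)}=\frac{\bar x_{0,k_0}}{\tilde x^{(j)}_{k_0}}\tilde x^{(j)}$, $\bar C_j=\frac{\tilde x^{(j)}_{k_0}}{\bar x_{0,k_0}}\tilde C_j$. Let $\bar x_0$ be one fixed $\bar x_0^{(j)}$ or the average $\frac1M\sum_j\bar x_0^{(j)}$. 4. Apply the corrections to $\bar\rho_0=\frac Id+\sum_k\bar x_{0,k}\Omega_k$ and $\bar P_j=\hat C_{j,0}\frac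 I{\sqrt d}+\sum_k\bar C_{j,k}\Omega_k$; the results are $\hat\rho_0$ and $\{\hat P_j\}$. The total number of copies is $N=(L+L'+2)N_0$, where $L'$ is the number of processes that are not TP. **Natural-basis algorithm (Problem 2).** The processes are arbitrary; only the $\hat y_{aj}$ are measured, $N=LN_0$. With $\mathcal B=[\operatorname{vec}(\mathcal B_1),\dots,\operatorname{vec}(\mathcal B_L)]^T$ let $\hat z_j=(\mathcal B^\dagger\mathcal B)^{-1}\mathcal B^\dagger\hat y_j$, $\hat y_j=(\hat y_{aj})_a$, and let $\operatorname{vec}(\tilde\rho^{(j)})\operatorname{vec}(\tilde P_j^T)^T$ be a leading singular term of the $d^2\times d^2$ matrix rearranged from $\hat z_j$ in the same way, the factors being rescaled so that $\operatorname{Tr}\tilde\rho^{(j)}=1$. Let $\tilde\rho_0$ be one fixed $\tilde\rho^{(j)}$ or the average of all of them, $\tilde\rho_0'=(\tilde\rho_0+\tilde\rho_0^\dagger)/2$, $\bar\rho_0=\tilde\rho_0'/\operatorname{Tr}\tilde\rho_0'$, $\bar P_j=(\tilde P_j+\tilde P_j^\dagger)/2$, and apply the corrections. **Theorem.** (a)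 Let all processes be generalized-unital, $\operatorname{rank}(B)=(d^2-1)^2$ and $x_{0,k_0}\ne0$. Then the orthonormal-basis algorithm satisfies $$\mathbb E\sum_{j=1}^M\|\hat P_j-P_j\|^2=O(1/N),$$ and, if $C_j\neq0$ (that is, $P_j$ is not a multiple of $I$) for every $j$ whose $\bar x_0^{(j)}$ is used in $\bar x_0$, also $$\mathbb E\|\hat\rho_0-\rho_0\|^2=O(1/N).$$ (b) Let $\operatorname{rank}(\mathcal B)=d^4$. Then the natural-basis algorithm satisfies $\mathbb E\sum_{j}\|\hat P_j-P_j\|^2=O(1/N)$ and, if $P_j\ne0$ for every $j$ whose $\tilde\rho^{(j)}$ is used in $\tilde\rho_0$, also $\mathbb E\|\hat\rho_0-\rho_0\|^2=O(1/N)$. Here $O(1/N)$ means a bound $K/N$ for all $N_0\ge1$, where $K$ depends on $\rho_0$, the detector, the processes and (in (a)) the basis and $k_0$, but neither on $N_0$ nor on the choice of the singular value decompositions. -/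

import Mathlib

open scoped Matrix Kronecker ComplexOrder

noncomputable section

namespace SimulTomo

/-! ### States, detectors, processes -/

/-- Density operators. -/
def IsDensity {d : ℕ} (ρ : Matrix (Fin d) (Fin d) ℂ) : Prop :=
  ρ.PosSemidef ∧ ρ.trace = 1

/-- Positive-operator-valued measures with `M` outcomes. -/
def IsPOVM {d M : ℕ} (P : Fin M → Matrix (Fin d) (Fin d) ℂ) : Prop :=
  (∀ j, (P j).PosSemidef) ∧ ∑ j, P j = 1

/-- The operator sum `∑ i, A i * X * (A i)†` of the Kraus operators `A`. -/
def applyKraus {d : ℕ} (A : Fin (d ^ 2) → Matrix (Fin d) (Fin d) ℂ)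
    (X : Matrix (Fin d) (Fin d) ℂ) : Matrix (Fin d) (Fin d) ℂ :=
  ∑ i, A i * X * (A i)ᴴ

/-- Kraus operators of a (possibly trace-decreasing) quantum process: `∑ i, (A i)† * A i ≤ 1`. -/
def IsProcess {d : ℕ} (A : Fin (d ^ 2) → Matrix (Fin d) (Fin d) ℂ) : Prop :=
  (1 - ∑ i, (A i)ᴴ * A i).PosSemidef

/-- Trace-preserving processes. -/
def IsTP {d : ℕ} (A : Fin (d ^ 2) → Matrix (Fin d) (Fin d) ℂ) : Prop :=
  ∑ i, (A i)ᴴ * A i = 1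

/-- Generalized-unital processes: the identity is mapped to `α` times itself, `0 < α ≤ 1`. -/
def IsGeneralizedUnital {d : ℕ} (A : Fin (d ^ 2) → Matrix (Fin d) (Fin d) ℂ) : Prop :=
  ∃ α : ℝ, 0 < α ∧ α ≤ 1 ∧ applyKraus A 1 = (α : ℂ) • (1 : Matrix (Fin d) (Fin d) ℂ)

/-! ### Orthonormal operator basis -/

/-- The `d ^ 2 - 1` elements of an orthonormal Hermitian operator basis that are traceless;
the remaining element of the basis is `1 / √d`. -/
structure IsTracelessBasis {d : ℕ} (Ω : Fin (d ^ 2 - 1) → Matrix (Fin d) (Fin d) ℂ) : Prop where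
  herm : ∀ k, (Ω k).IsHermitian
  trace_zero : ∀ k, (Ω k).trace = 0
  orthonormal : ∀ k l, ((Ω k)ᴴ * Ω l).trace = if k = l then 1 else 0

/-- The complete basis; `none` is the index of the element `1 / √d`. -/
def fullBasis {d : ℕ} (Ω : Fin (d ^ 2 - 1) → Matrix (Fin d) (Fin d) ℂ) :
    Option (Fin (d ^ 2 - 1)) → Matrix (Fin d) (Fin d) ℂ
  | none => ((1 / Real.sqrt d : ℝ) : ℂ) • 1
  | some k => Ω k

/-- The change of basis matrix, whose rows are the conjugated vectorized basis elements. -/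
def basisChange {d : ℕ} (Ω : Fin (d ^ 2 - 1) → Matrix (Fin d) (Fin d) ℂ) :
    Matrix (Option (Fin (d ^ 2 - 1))) (Fin d × Fin d) ℂ :=
  Matrix.of fun k p => star (Matrix.vec (fullBasis Ω k) p)

/-- The coefficient of a Hermitian operator `X` at the basis element `Ω k`. -/
def coeff {d : ℕ} (Ω : Fin (d ^ 2 - 1) → Matrix (Fin d) (Fin d) ℂ)
    (X : Matrix (Fin d) (Fin d) ℂ) (k : Fin (d ^ 2 - 1)) : ℝ :=
  (Ω k * X).trace.re

/-- The matrix `∑ i, (A i)^* ⊗ A i` of a process in the natural basis. -/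
def naturalMatrix {d : ℕ} (A : Fin (d ^ 2) → Matrix (Fin d) (Fin d) ℂ) :
    Matrix (Fin d × Fin d) (Fin d × Fin d) ℂ :=
  ∑ i, (A i).map star ⊗ₖ A i

/-- The traceless block of the matrix of a process in the basis `fullBasis Ω`
(this matrix has real entries). -/
def tracelessBlock {d : ℕ} (Ω : Fin (d ^ 2 - 1) → Matrix (Fin d) (Fin d) ℂ)
    (A : Fin (d ^ 2) → Matrix (Fin d) (Fin d) ℂ) :
    Matrix (Fin (d ^ 2 - 1)) (Fin (d ^ 2 - 1)) ℝ :=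
  Matrix.of fun k l =>
    ((basisChange Ω * naturalMatrix A * (basisChange Ω)ᴴ) (some k) (some l)).re

/-- The matrix `B` of the orthonormal-basis formulation: row `a` is the vectorized traceless
block of the `a`-th process. -/
def designB {d L : ℕ} (Ω : Fin (d ^ 2 - 1) → Matrix (Fin d) (Fin d) ℂ)
    (A : Fin L → Fin (d ^ 2) → Matrix (Fin d) (Fin d) ℂ) :
    Matrix (Fin L) (Fin (d ^ 2 - 1) × Fin (d ^ 2 - 1)) ℝ :=
  Matrix.of fun a => Matrix.vec (tracelessBlock Ω (A a))

/-- The matrix `𝓑` of the natural-basis formulation. -/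
def designNatural {d L : ℕ} (A : Fin L → Fin (d ^ 2) → Matrix (Fin d) (Fin d) ℂ) :
    Matrix (Fin L) ((Fin d × Fin d) × (Fin d × Fin d)) ℂ :=
  Matrix.of fun a => Matrix.vec (naturalMatrix (A a))

/-! ### Measurement records and their probabilities (Born's rule) -/

/-- The probability of a sequence of independent outcomes with the distribution `p`. -/
def seqProb {α : Type*} {n : ℕ} (p : α → ℝ) (s : Fin n → α) : ℝ := ∏ i, p (s i)

open scoped Classical in
/-- The relative frequency of the outcome `x` in a sequence of outcomes. -/
def freq {α : Type*} {n : ℕ} (s : Fin n → α) (x : α) : ℝ :=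
  ((Finset.univ.filter fun i => s i = x).card : ℝ) / n

/-- Distribution of the outcome when the detector `P` is applied to a copy of the output of a
process. The outcome `none` is the loss of the copy; its probability is `1 - Tr σ`. -/
def detectProb {d M : ℕ} (P : Fin M → Matrix (Fin d) (Fin d) ℂ)
    (σ : Matrix (Fin d) (Fin d) ℂ) : Option (Fin M) → ℝ
  | some j => (P j * σ).trace.re
  | none => 1 - σ.trace.re

/-- Distribution of the outcome of the measurement operator `1` on the output of a process. -/
def identityProb {d : ℕ} (σ : Matrix (Fin d) (Fin d) ℂ) : Bool → ℝ
  | true => σ.trace.re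
  | false => 1 - σ.trace.re

/-- Distribution of the detector outcome on the maximally mixed state. -/
def mixedProb {d M : ℕ} (P : Fin M → Matrix (Fin d) (Fin d) ℂ) (j : Fin M) : ℝ :=
  (P j * (((1 / d : ℝ) : ℂ) • (1 : Matrix (Fin d) (Fin d) ℂ))).trace.re

/-- Distribution of the outcome of the projective measurement of the observable `O` on `ρ`:
outcome `i` is the `i`-th vector of an eigenbasis of `O`. -/
def observableProb {d : ℕ} {O : Matrix (Fin d) (Fin d) ℂ} (hO : O.IsHermitian)
    (ρ : Matrix (Fin d) (Fin d) ℂ) (i : Fin d) : ℝ :=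
  (((hO.eigenvectorUnitary : Matrix (Fin d) (Fin d) ℂ)ᴴ * ρ *
    (hO.eigenvectorUnitary : Matrix (Fin d) (Fin d) ℂ)) i i).re

/-- Detector outcomes on `N₀` copies of the output of each process. -/
abbrev OutputRecord (L M N₀ : ℕ) : Type := Fin L → Fin N₀ → Option (Fin M)

/-- All outcomes used by the orthonormal-basis algorithm, in this order: detector on the outputs
of the processes; operator `1` on the outputs of those processes that are not trace-preserving;
detector on the maximally mixed state; the observable on the unknown state. -/
abbrev FullRecord {d L : ℕ} (A : Fin L → Fin (d ^ 2) → Matrix (Fin d) (Fin d) ℂ)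
    (M N₀ : ℕ) : Type :=
  OutputRecord L M N₀ × ({a : Fin L // ¬ IsTP (A a)} → Fin N₀ → Bool) ×
    (Fin N₀ → Fin M) × (Fin N₀ → Fin d)

/-- The probability of a record of detector outcomes on the outputs of the processes. -/
def outputRecordProb {d L M N₀ : ℕ} (A : Fin L → Fin (d ^ 2) → Matrix (Fin d) (Fin d) ℂ)
    (ρ₀ : Matrix (Fin d) (Fin d) ℂ) (P : Fin M → Matrix (Fin d) (Fin d) ℂ)
    (r : OutputRecord L M N₀) : ℝ :=
  ∏ a, seqProb (detectProb P (applyKraus (A a) ρ₀)) (r a)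

open scoped Classical in
/-- The probability of a full record. -/
def fullRecordProb {d L M N₀ : ℕ} (A : Fin L → Fin (d ^ 2) → Matrix (Fin d) (Fin d) ℂ)
    (ρ₀ : Matrix (Fin d) (Fin d) ℂ) (P : Fin M → Matrix (Fin d) (Fin d) ℂ)
    {O : Matrix (Fin d) (Fin d) ℂ} (hO : O.IsHermitian) (r : FullRecord A M N₀) : ℝ :=
  outputRecordProb A ρ₀ P r.1 *
    (∏ a : {a : Fin L // ¬ IsTP (A a)},
      seqProb (identityProb (applyKraus (A a.1) ρ₀)) (r.2.1 a)) *
    seqProb (mixedProb P) r.2.2.1 * seqProb (observableProb hO ρ₀) r.2.2.2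

open scoped Classical in
/-- Expectation over all full records. -/
def fullExpectation {d L M N₀ : ℕ} (A : Fin L → Fin (d ^ 2) → Matrix (Fin d) (Fin d) ℂ)
    (ρ₀ : Matrix (Fin d) (Fin d) ℂ) (P : Fin M → Matrix (Fin d) (Fin d) ℂ)
    {O : Matrix (Fin d) (Fin d) ℂ} (hO : O.IsHermitian) (f : FullRecord A M N₀ → ℝ) : ℝ :=
  ∑ r, fullRecordProb A ρ₀ P hO r * f r

/-- Expectation over all records of detector outcomes on the outputs of the processes. -/
def outputExpectation {d L M N₀ : ℕ} (A : Fin L → Fin (d ^ 2) → Matrix (Fin d) (Fin d) ℂ)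
    (ρ₀ : Matrix (Fin d) (Fin d) ℂ) (P : Fin M → Matrix (Fin d) (Fin d) ℂ)
    (f : OutputRecord L M N₀ → ℝ) : ℝ :=
  ∑ r, outputRecordProb A ρ₀ P r * f r

open scoped Classical in
/-- Total number of state copies in a full record with `N₀` copies per experiment. It is
`(L + 2) * N₀` if all processes are trace-preserving and `(2 * L + 2) * N₀` if none is. -/
def fullCopies {d L : ℕ} (A : Fin L → Fin (d ^ 2) → Matrix (Fin d) (Fin d) ℂ) (N₀ : ℕ) : ℕ :=
  (L + Fintype.card {a : Fin L // ¬ IsTP (A a)} + 2) * N₀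

/-- Squared Frobenius norm. -/
def frobSq {d : ℕ} (X : Matrix (Fin d) (Fin d) ℂ) : ℝ := ∑ i, ∑ j, ‖X i j‖ ^ 2

/-! ### Estimates computed from the raw data -/

/-- Estimate of `Tr (P j ρ_a)`. -/
def yHat {L M N₀ : ℕ} (r : OutputRecord L M N₀) (a : Fin L) (j : Fin M) : ℝ :=
  freq (r a) (some j)

open scoped Classical in
/-- Estimate of `Tr (ρ_a) / √d`; no measurement is needed for a trace-preserving process. -/
def xHatZero {d L M N₀ : ℕ} {A : Fin L → Fin (d ^ 2) → Matrix (Fin d) (Fin d) ℂ}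
    (r : FullRecord A M N₀) (a : Fin L) : ℝ :=
  if h : IsTP (A a) then 1 / Real.sqrt d else freq (r.2.1 ⟨a, h⟩) true / Real.sqrt d

/-- Estimate of the coefficient `Tr (P j) / √d` of `P j` at the basis element `1 / √d`. -/
def cHatZero {d L M N₀ : ℕ} {A : Fin L → Fin (d ^ 2) → Matrix (Fin d) (Fin d) ℂ}
    (r : FullRecord A M N₀) (j : Fin M) : ℝ :=
  Real.sqrt d * freq r.2.2.1 j

/-- Estimate of the mean value of the observable in the unknown state: the average of the
observed eigenvalues. -/
def observableMean {d L M N₀ : ℕ} {A : Fin L → Fin (d ^ 2) → Matrix (Fin d) (Fin d) ℂ}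
    {O : Matrix (Fin d) (Fin d) ℂ} (hO : O.IsHermitian) (r : FullRecord A M N₀) : ℝ :=
  (∑ i, hO.eigenvalues (r.2.2.2 i)) / N₀

/-- The data vector of outcome `j` with the contribution of the traces removed. -/
def YHat {d L M N₀ : ℕ} {A : Fin L → Fin (d ^ 2) → Matrix (Fin d) (Fin d) ℂ}
    (r : FullRecord A M N₀) (j : Fin M) (a : Fin L) : ℝ :=
  yHat r.1 a j - xHatZero r a * cHatZero r j

/-! ### Least squares and nearest Kronecker product -/

/-- The least squares solution `(B† B)⁻¹ B† Y`. -/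
def leastSquares {𝕜 : Type*} [RCLike 𝕜] {m n : Type*} [Fintype m] [Fintype n] [DecidableEq n]
    (B : Matrix m n 𝕜) (Y : m → 𝕜) : n → 𝕜 :=
  (Bᴴ * B)⁻¹ *ᵥ (Bᴴ *ᵥ Y)

/-- `T = U * Σ * V†` is a singular value decomposition (in any order of the singular values). -/
def IsSVD {𝕜 : Type*} [RCLike 𝕜] {n : Type*} [Fintype n] [DecidableEq n]
    (T U : Matrix n n 𝕜) (s : n → ℝ) (V : Matrix n n 𝕜) : Prop :=
  U ∈ Matrix.unitaryGroup n 𝕜 ∧ V ∈ Matrix.unitaryGroup n 𝕜 ∧ (∀ i, 0 ≤ s i) ∧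
    T = U * Matrix.diagonal (fun i => (s i : 𝕜)) * Vᴴ

/-- `x` and `c` are Kronecker factors of `z` found by the singular value decomposition: `z` is
rearranged into the matrix `T` with `T k l = z (k, l)`, and `x cᵀ` is the term of a largest
singular value of `T`. The factors are determined up to `(q x, c / q)` only. -/
def IsSVDFactor {𝕜 : Type*} [RCLike 𝕜] {n : Type*} [Fintype n] [DecidableEq n]
    (z : n × n → 𝕜) (x c : n → 𝕜) : Prop :=
  ∃ (U : Matrix n n 𝕜) (s : n → ℝ) (V : Matrix n n 𝕜) (i₀ : n),
    IsSVD (Matrix.of fun k l => z (k, l)) U s V ∧ (∀ i, s i ≤ s i₀) ∧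
      ∀ k l, x k * c l = (s i₀ : 𝕜) * U k i₀ * star (V l i₀)

/-- The two ways to obtain one estimate of the state from the `M` estimates, one per outcome. -/
inductive StateChoice (M : ℕ) : Type
  | single (j : Fin M)
  | average

/-- The outcomes whose state estimates are used. -/
def StateChoice.Uses {M : ℕ} : StateChoice M → Fin M → Prop
  | .single j, i => i = j
  | .average, _ => True

/-- The estimate chosen from the `M` estimates. -/
def StateChoice.combine {M : ℕ} {E : Type*} [AddCommGroup E] [Module ℝ E] :
    StateChoice M → (Fin M → E) → E
  | .single j, v => v j
  | .average, v => ((1 / M : ℝ)) • ∑ j, v j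

/-! ### Physical corrections -/

/-- The fast correction of a real sequence `lam` in decreasing order with sum `1` to a probability
vector `mu`: going from the smallest entry up, an entry is set to zero, and its value is spread
evenly over the entries before it, as long as the corrected entry is negative. Here `m` is the
last entry that is kept. -/
def IsFastCorrection {d : ℕ} (lam mu : Fin d → ℝ) : Prop :=
  ∃ m : Fin d,
    0 ≤ lam m + (∑ k ∈ Finset.Ioi m, lam k) / ((m : ℕ) + 1 : ℝ) ∧
    (∀ i, m < i → lam i + (∑ k ∈ Finset.Ioi i, lam k) / ((i : ℕ) + 1 : ℝ) < 0) ∧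
    ∀ i, mu i =
      if i ≤ m then lam i + (∑ k ∈ Finset.Ioi m, lam k) / ((m : ℕ) + 1 : ℝ) else 0

/-- `ρh` is the density operator obtained from the Hermitian operator `ρb` of trace one by the
fast correction of its eigenvalues. If `ρb` does not have trace one (which happens only if an
earlier normalization was impossible), any density operator may be returned. -/
def IsStateCorrection {d : ℕ} (ρb ρh : Matrix (Fin d) (Fin d) ℂ) : Prop :=
  IsDensity ρh ∧
    (ρb.trace = 1 →
      ∃ (V : Matrix (Fin d) (Fin d) ℂ) (lam mu : Fin d → ℝ),
        V ∈ Matrix.unitaryGroup (Fin d) ℂ ∧ Antitone lam ∧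
        ρb = V * Matrix.diagonal (fun i => (lam i : ℂ)) * Vᴴ ∧
        IsFastCorrection lam mu ∧
        ρh = V * Matrix.diagonal (fun i => (mu i : ℂ)) * Vᴴ)

/-- `F` is the positive part of the Hermitian matrix `X`. -/
def IsPositivePart {d : ℕ} (X F : Matrix (Fin d) (Fin d) ℂ) : Prop :=
  ∃ (V : Matrix (Fin d) (Fin d) ℂ) (lam : Fin d → ℝ),
    V ∈ Matrix.unitaryGroup (Fin d) ℂ ∧
    X = V * Matrix.diagonal (fun i => (lam i : ℂ)) * Vᴴ ∧
    F = V * Matrix.diagonal (fun i => ((max (lam i) 0 : ℝ) : ℂ)) * Vᴴ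

/-- `Ph` is the detector obtained from the Hermitian matrices `Pb`: with the positive parts `F j`
and `S = ∑ j, F j`, one takes `S^(-1/2) * F j * S^(-1/2)`. If `S` is singular, any detector may
be returned. -/
def IsDetectorCorrection {d M : ℕ} (Pb Ph : Fin M → Matrix (Fin d) (Fin d) ℂ) : Prop :=
  IsPOVM Ph ∧
    ∃ F : Fin M → Matrix (Fin d) (Fin d) ℂ, (∀ j, IsPositivePart (Pb j) (F j)) ∧
      (IsUnit (∑ j, F j).det →
        ∃ R : Matrix (Fin d) (Fin d) ℂ, R.PosSemidef ∧ R * R = ∑ j, F j ∧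
          ∀ j, Ph j = R⁻¹ * F j * R⁻¹)

/-! ### The two closed-form algorithms -/

/-- `(ρh, Ph)` is an output of the closed-form algorithm in the orthonormal basis on the record
`r`, where the coefficient of the state at `Ω k₀` is the one that was measured. A quotient with
denominator zero is read as zero. -/
def IsOrthonormalOutput {d L M N₀ : ℕ} {Ω : Fin (d ^ 2 - 1) → Matrix (Fin d) (Fin d) ℂ}
    (hΩ : IsTracelessBasis Ω) (k₀ : Fin (d ^ 2 - 1))
    (A : Fin L → Fin (d ^ 2) → Matrix (Fin d) (Fin d) ℂ) (ch : StateChoice M)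
    (r : FullRecord A M N₀)
    (ρh : Matrix (Fin d) (Fin d) ℂ) (Ph : Fin M → Matrix (Fin d) (Fin d) ℂ) : Prop :=
  ∃ xt ct : Fin M → Fin (d ^ 2 - 1) → ℝ,
    (∀ j, IsSVDFactor (leastSquares (designB Ω A) (YHat r j)) (xt j) (ct j)) ∧
    ∃ (xb : Fin (d ^ 2 - 1) → ℝ) (cb : Fin M → Fin (d ^ 2 - 1) → ℝ),
      xb = ch.combine (fun j => (observableMean (hΩ.herm k₀) r / xt j k₀) • xt j) ∧
      (∀ j, cb j = (xt j k₀ / observableMean (hΩ.herm k₀) r) • ct j) ∧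
      IsStateCorrection
        (((1 / Real.sqrt d : ℝ) : ℂ) • fullBasis Ω none + ∑ k, (xb k : ℂ) • Ω k) ρh ∧
      IsDetectorCorrection
        (fun j => (cHatZero r j : ℂ) • fullBasis Ω none + ∑ k, (cb j k : ℂ) • Ω k) Ph

/-- `(ρh, Ph)` is an output of the closed-form algorithm in the natural basis on the record `r`.
The free factor in the Kronecker factors of each outcome is fixed by giving the state factor trace
one. A quotient with denominator zero is read as zero. -/
def IsNaturalOutput {d L M N₀ : ℕ}
    (A : Fin L → Fin (d ^ 2) → Matrix (Fin d) (Fin d) ℂ) (ch : StateChoice M)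
    (r : OutputRecord L M N₀)
    (ρh : Matrix (Fin d) (Fin d) ℂ) (Ph : Fin M → Matrix (Fin d) (Fin d) ℂ) : Prop :=
  ∃ ρs Ps : Fin M → Matrix (Fin d) (Fin d) ℂ,
    (∀ j, IsSVDFactor (leastSquares (designNatural A) (fun a => (yHat r a j : ℂ)))
      (Matrix.vec (ρs j)) (Matrix.vec (Ps j)ᵀ)) ∧
    ∃ (ρt ρ' : Matrix (Fin d) (Fin d) ℂ) (Pt : Fin M → Matrix (Fin d) (Fin d) ℂ),
      ρt = ch.combine (fun j => (ρs j).trace⁻¹ • ρs j) ∧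
      (∀ j, Pt j = (ρs j).trace • Ps j) ∧
      ρ' = (1 / 2 : ℂ) • (ρt + ρtᴴ) ∧
      IsStateCorrection (ρ'.trace⁻¹ • ρ') ρh ∧
      IsDetectorCorrection (fun j => (1 / 2 : ℂ) • (Pt j + (Pt j)ᴴ)) Ph

end SimulTomo

end

/-! The probability of outcome `j` on the output of a process is bilinear in state and detector
element, hence linear in the products of their coordinates. In the orthonormal basis this holds for
the traceless coordinates, once the product of the identity components is subtracted, because
generalized-unital processes do not mix the identity into the traceless part. Full column rank
recovers these products, and they form a matrix of rank at most one.

Least squares is a fixed linear map, so it passes data errors on linearly. A leading singular term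
is a best rank-one approximation, so it is at most twice as far from the exact rank-one matrix as
the least squares matrix is (`IsSVDFactor.norm_vecMulVec_sub_le`). This needs no gap between
singular values and holds for every choice of the decomposition. The later formulas depend only on
products of an entry of one factor with an entry of the other, so the free scalar cancels, and they
divide only by quantities with nonzero limit. The state correction is the metric projection onto the
density operators and does not increase the distance to the true state; the detector correction is
Lipschitz at a detector.

Let `e ^ 2` be the total squared error of the raw data. The above gives an output error `O(e)` as
`e` tends to 0. For records with large `e` the outputs are still physical, hence bounded, so the
squared output error is at most `K * e ^ 2` for every record (`exists_sq_bound`). No tail estimate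
is needed: it remains to take the expectation of `e ^ 2`, which is `O(1 / N₀)` by the variance of
averages of independent outcomes, and `N` is a fixed multiple of `N₀`. -/

open scoped Matrix.Norms.Frobenius

namespace SimulTomo

/-! ### The Frobenius norm -/

section Frobenius

variable {𝕜 : Type*} [RCLike 𝕜] {m n : Type*} [Fintype m] [Fintype n]

theorem frobenius_norm_sq (X : Matrix m n 𝕜) : ‖X‖ ^ 2 = ∑ i, ∑ j, ‖X i j‖ ^ 2 := by
  rw [Matrix.frobenius_norm_def, ← Real.sqrt_eq_rpow, Real.sq_sqrt (by positivity)]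
  simp

theorem frobSq_eq_norm_sq {d : ℕ} (X : Matrix (Fin d) (Fin d) ℂ) : frobSq X = ‖X‖ ^ 2 :=
  (frobenius_norm_sq X).symm

theorem norm_apply_le (X : Matrix m n 𝕜) (i : m) (j : n) : ‖X i j‖ ≤ ‖X‖ := by
  refine le_of_sq_le_sq ?_ (norm_nonneg _)
  rw [frobenius_norm_sq]
  exact (Finset.single_le_sum (f := fun j => ‖X i j‖ ^ 2) (fun _ _ => by positivity)
    (Finset.mem_univ j)).trans (Finset.single_le_sum (f := fun i => ∑ j, ‖X i j‖ ^ 2)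
      (fun _ _ => by positivity) (Finset.mem_univ i))

theorem frobenius_norm_le_sum (X : Matrix m n 𝕜) : ‖X‖ ≤ ∑ i, ∑ j, ‖X i j‖ := by
  classical
  calc ‖X‖ = ‖∑ i, ∑ j, Matrix.single i j (X i j)‖ := by rw [← Matrix.matrix_eq_sum_single]
    _ ≤ ∑ i, ∑ j, ‖Matrix.single i j (X i j)‖ :=
      (norm_sum_le _ _).trans (Finset.sum_le_sum fun i _ => norm_sum_le _ _)
    _ = ∑ i, ∑ j, ‖X i j‖ := by
      refine Finset.sum_congr rfl fun i _ => Finset.sum_congr rfl fun j _ => ?_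
      refine (pow_left_inj₀ (norm_nonneg _) (norm_nonneg _) two_ne_zero).1 ?_
      rw [frobenius_norm_sq, Finset.sum_eq_single i, Finset.sum_eq_single j]
      · simp
      · intro b _ hb; simp [hb.symm]
      · simp
      · intro b _ hb; simp [hb.symm]
      · simp

theorem frobenius_norm_sq_eq_trace (X : Matrix m n 𝕜) :
    ‖X‖ ^ 2 = RCLike.re (Xᴴ * X).trace := by
  rw [frobenius_norm_sq, Finset.sum_comm]
  simp only [Matrix.trace, Matrix.diag_apply, Matrix.mul_apply, Matrix.conjTranspose_apply,
    RCLike.star_def, RCLike.conj_mul, ← RCLike.ofReal_pow, map_sum, RCLike.ofReal_re]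

theorem frobenius_norm_add_sq (X Y : Matrix m n 𝕜) :
    ‖X + Y‖ ^ 2 = ‖X‖ ^ 2 + ‖Y‖ ^ 2 + 2 * RCLike.re (Xᴴ * Y).trace := by
  have h : RCLike.re (Yᴴ * X).trace = RCLike.re (Xᴴ * Y).trace := by
    rw [← Matrix.conjTranspose_conjTranspose X, ← Matrix.conjTranspose_mul,
      Matrix.trace_conjTranspose, Matrix.conjTranspose_conjTranspose, RCLike.star_def,
      RCLike.conj_re]
  simp only [frobenius_norm_sq_eq_trace, Matrix.conjTranspose_add, Matrix.add_mul,
    Matrix.mul_add,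
    Matrix.trace_add, map_add, h]
  ring

theorem frobenius_norm_unitary_mul [DecidableEq m] {U : Matrix m m 𝕜} (hU : U ∈ Matrix.unitaryGroup m 𝕜)
    (X : Matrix m n 𝕜) : ‖U * X‖ = ‖X‖ := by
  refine (pow_left_inj₀ (norm_nonneg _) (norm_nonneg _) two_ne_zero).1 ?_
  have h : Uᴴ * U = 1 := Matrix.mem_unitaryGroup_iff'.1 hU
  rw [frobenius_norm_sq_eq_trace, frobenius_norm_sq_eq_trace, Matrix.conjTranspose_mul,
    Matrix.mul_assoc, ← Matrix.mul_assoc Uᴴ, h, Matrix.one_mul]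

theorem frobenius_norm_mul_unitary [DecidableEq n] {V : Matrix n n 𝕜} (hV : V ∈ Matrix.unitaryGroup n 𝕜)
    (X : Matrix m n 𝕜) : ‖X * V‖ = ‖X‖ := by
  rw [← Matrix.frobenius_norm_conjTranspose, Matrix.conjTranspose_mul,
    ← Matrix.star_eq_conjTranspose V,
    frobenius_norm_unitary_mul (Unitary.star_mem hV), Matrix.frobenius_norm_conjTranspose]

end Frobenius

/-! ### The leading singular term is a best approximation of rank one -/

section LeadingTerm

variable {𝕜 : Type*} [RCLike 𝕜] {n : Type*} [Fintype n] [DecidableEq n]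

/-- The Eckart–Young bound for rank one. With `t = ‖a bᵀ‖`, Cauchy–Schwarz bounds the cross term by
`s i₀ * t`, and `t ^ 2 - 2 * s i₀ * t` is never below `-s i₀ ^ 2`. -/
theorem norm_diagonal_sub_vecMulVec_sq_ge (s : n → ℝ) (hs : ∀ i, 0 ≤ s i) (i₀ : n)
    (h₀ : ∀ i, s i ≤ s i₀) (a b : n → 𝕜) :
    ∑ i, s i ^ 2 - s i₀ ^ 2 ≤
      ‖Matrix.diagonal (fun i => (s i : 𝕜)) - Matrix.vecMulVec a b‖ ^ 2 := by
  have hab : ‖Matrix.vecMulVec a b‖ ^ 2 = (∑ i, ‖a i‖ ^ 2) * ∑ i, ‖b i‖ ^ 2 := by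
    simp [frobenius_norm_sq, Matrix.vecMulVec_apply, mul_pow, Finset.sum_mul_sum]
  have hdiag : ‖Matrix.diagonal (fun i => (s i : 𝕜))‖ ^ 2 = ∑ i, s i ^ 2 := by
    simp only [frobenius_norm_sq, Matrix.diagonal_apply]
    refine Finset.sum_congr rfl fun i _ => ?_
    rw [Finset.sum_eq_single i] <;> simp +contextual [eq_comm]
  have hcross : RCLike.re ((Matrix.diagonal (fun i => (s i : 𝕜)))ᴴ *
      Matrix.vecMulVec a b).trace = ∑ i, s i * RCLike.re (a i * b i) := by
    simp [Matrix.trace, Matrix.diagonal_conjTranspose, Matrix.diagonal_mul,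
      Matrix.vecMulVec_apply, -RCLike.mul_re, RCLike.re_ofReal_mul]
  have hcs : ∑ i, s i * RCLike.re (a i * b i) ≤ s i₀ * ‖Matrix.vecMulVec a b‖ := by
    calc ∑ i, s i * RCLike.re (a i * b i) ≤ ∑ i, s i₀ * (‖a i‖ * ‖b i‖) := by
          refine Finset.sum_le_sum fun i _ => ?_
          rw [← norm_mul]
          exact (mul_le_mul_of_nonneg_left (RCLike.re_le_norm _) (hs i)).trans
            (mul_le_mul_of_nonneg_right (h₀ i) (norm_nonneg _))
      _ = s i₀ * ∑ i, ‖a i‖ * ‖b i‖ := by rw [Finset.mul_sum]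
      _ ≤ s i₀ * ‖Matrix.vecMulVec a b‖ := by
          refine mul_le_mul_of_nonneg_left (le_of_sq_le_sq ?_ (norm_nonneg _)) (hs _)
          rw [hab]
          exact Finset.sum_mul_sq_le_sq_mul_sq _ _ _
  have key := frobenius_norm_add_sq (Matrix.diagonal (fun i => (s i : 𝕜)))
    (-Matrix.vecMulVec a b)
  rw [← sub_eq_add_neg, norm_neg, Matrix.mul_neg, Matrix.trace_neg, map_neg, hcross,
    hdiag] at key
  nlinarith [sq_nonneg (‖Matrix.vecMulVec a b‖ - s i₀)]

/-- The Frobenius norm is invariant under the two unitary factors, so the comparison reduces to the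
diagonal case. There, dropping the leading term leaves exactly the lower bound of
`norm_diagonal_sub_vecMulVec_sq_ge`. -/
theorem IsSVDFactor.norm_sub_le {z : n × n → 𝕜} {x c : n → 𝕜} (h : IsSVDFactor z x c)
    (a b : n → 𝕜) :
    ‖Matrix.of (fun k l => z (k, l)) - Matrix.vecMulVec x c‖ ≤
      ‖Matrix.of (fun k l => z (k, l)) - Matrix.vecMulVec a b‖ := by
  obtain ⟨U, s, V, i₀, ⟨hU, hV, hs, hT⟩, h₀, hx⟩ := h
  have hUU : Uᴴ * U = 1 := Matrix.mem_unitaryGroup_iff'.1 hU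
  have hUU' : U * Uᴴ = 1 := Matrix.mem_unitaryGroup_iff.1 hU
  have hVV' : V * Vᴴ = 1 := Matrix.mem_unitaryGroup_iff.1 hV
  have hrank : Matrix.vecMulVec x c =
      U * Matrix.diagonal (fun i => if i = i₀ then (s i : 𝕜) else 0) * Vᴴ := by
    ext k l
    rw [Matrix.vecMulVec_apply, hx, Matrix.mul_apply, Finset.sum_eq_single i₀]
    · simp only [Matrix.mul_diagonal, if_true, Matrix.conjTranspose_apply]; ring
    · intro i _ hi; simp [Matrix.mul_diagonal, hi]
    · simp
  have h1 : ‖Matrix.of (fun k l => z (k, l)) - Matrix.vecMulVec x c‖ ^ 2 =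
      ∑ i, s i ^ 2 - s i₀ ^ 2 := by
    rw [hT, hrank, ← Matrix.sub_mul, ← Matrix.mul_sub, ← Matrix.star_eq_conjTranspose V,
      frobenius_norm_mul_unitary (Unitary.star_mem hV), frobenius_norm_unitary_mul hU,
      Matrix.diagonal_sub, frobenius_norm_sq, ← Finset.sum_erase_add _ _ (Finset.mem_univ i₀),
      ← Finset.sum_erase_add _ (fun i => s i ^ 2) (Finset.mem_univ i₀)]
    simp only [add_sub_cancel_right]
    rw [add_eq_left.2]
    · refine Finset.sum_congr rfl fun i hi => ?_
      rw [Finset.sum_eq_single i]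
      · simp [(Finset.mem_erase.1 hi).1]
      · intro j _ hj; simp [Matrix.diagonal_apply_ne _ hj.symm]
      · simp
    · refine Finset.sum_eq_zero fun j _ => ?_
      by_cases hj : i₀ = j <;> simp [hj]
  have h2 : Matrix.vecMulVec a b =
      U * Matrix.vecMulVec (Uᴴ *ᵥ a) (b ᵥ* V) * Vᴴ := by
    rw [Matrix.mul_vecMulVec, Matrix.vecMulVec_mul, Matrix.mulVec_mulVec, Matrix.vecMul_vecMul,
      hUU', hVV', Matrix.one_mulVec, Matrix.vecMul_one]
  refine le_of_sq_le_sq ?_ (norm_nonneg _)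
  rw [h1]
  refine (norm_diagonal_sub_vecMulVec_sq_ge s hs i₀ h₀ (Uᴴ *ᵥ a) (b ᵥ* V)).trans_eq ?_
  rw [hT, h2, ← Matrix.sub_mul, ← Matrix.mul_sub, ← Matrix.star_eq_conjTranspose V,
    frobenius_norm_mul_unitary (Unitary.star_mem hV), frobenius_norm_unitary_mul hU]

/-- Triangle inequality through the rearranged `z`: by optimality, `x cᵀ` is no farther from it than
`a bᵀ`. The target may be zero, where the singular vectors themselves are not stable. -/
theorem IsSVDFactor.norm_vecMulVec_sub_le {z : n × n → 𝕜} {x c : n → 𝕜}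
    (h : IsSVDFactor z x c) (a b : n → 𝕜) :
    ‖Matrix.vecMulVec x c - Matrix.vecMulVec a b‖ ≤
      2 * ‖Matrix.of (fun k l => z (k, l)) - Matrix.vecMulVec a b‖ := by
  have h1 := h.norm_sub_le a b
  have h2 := norm_sub_le_norm_sub_add_norm_sub (Matrix.vecMulVec x c)
    (Matrix.of (fun k l => z (k, l))) (Matrix.vecMulVec a b)
  rw [norm_sub_rev (Matrix.vecMulVec x c) (Matrix.of _)] at h2
  linarith

end LeadingTerm

/-! ### The corrections as projections -/

section Corrections

variable {d : ℕ}

theorem trace_unitary_diagonal_mul (V σ : Matrix (Fin d) (Fin d) ℂ) (w : Fin d → ℝ) :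
    (V * Matrix.diagonal (fun i => (w i : ℂ)) * Vᴴ * σ).trace.re =
      ∑ i, w i * ((Vᴴ * σ * V) i i).re := by
  rw [Matrix.mul_assoc, Matrix.mul_assoc, Matrix.trace_mul_comm, Matrix.mul_assoc]
  simp [Matrix.trace, Matrix.diagonal_mul]

theorem trace_unitary_diagonal_mul_nonpos (V : Matrix (Fin d) (Fin d) ℂ)
    {σ : Matrix (Fin d) (Fin d) ℂ} (hσ : σ.PosSemidef) {w : Fin d → ℝ} (hw : ∀ i, w i ≤ 0) :
    (V * Matrix.diagonal (fun i => (w i : ℂ)) * Vᴴ * σ).trace.re ≤ 0 := by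
  rw [trace_unitary_diagonal_mul]
  refine Finset.sum_nonpos fun i _ => mul_nonpos_of_nonpos_of_nonneg (hw i) ?_
  exact (Complex.le_def.1 ((hσ.conjTranspose_mul_mul_same V).diag_nonneg (i := i))).1

theorem trace_unitary_diagonal_mul_self {V : Matrix (Fin d) (Fin d) ℂ}
    (hV : V ∈ Matrix.unitaryGroup (Fin d) ℂ) (w v : Fin d → ℝ) :
    (V * Matrix.diagonal (fun i => (w i : ℂ)) * Vᴴ *
      (V * Matrix.diagonal (fun i => (v i : ℂ)) * Vᴴ)).trace.re = ∑ i, w i * v i := by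
  have hVV : Vᴴ * V = 1 := Matrix.mem_unitaryGroup_iff'.1 hV
  rw [trace_unitary_diagonal_mul]
  have : Vᴴ * (V * Matrix.diagonal (fun i => (v i : ℂ)) * Vᴴ) * V =
      Matrix.diagonal (fun i => (v i : ℂ)) := by
    rw [← Matrix.mul_assoc, ← Matrix.mul_assoc, hVV, Matrix.one_mul, Matrix.mul_assoc, hVV,
      Matrix.mul_one]
  simp [this]

theorem isHermitian_unitary_diagonal (V : Matrix (Fin d) (Fin d) ℂ) (w : Fin d → ℝ) :
    (V * Matrix.diagonal (fun i => (w i : ℂ)) * Vᴴ).IsHermitian := by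
  refine Matrix.isHermitian_mul_mul_conjTranspose V ?_
  exact Matrix.isHermitian_diagonal_of_self_adjoint _ (by ext i; simp)

/-- The variational inequality implies that a projection does not increase distances. -/
theorem norm_sub_le_of_trace_nonpos {X F σ : Matrix (Fin d) (Fin d) ℂ}
    (hXF : (X - F).IsHermitian) (h : ((X - F) * (σ - F)).trace.re ≤ 0) :
    ‖F - σ‖ ≤ ‖X - σ‖ := by
  refine le_of_sq_le_sq ?_ (norm_nonneg _)
  have key := frobenius_norm_add_sq (X - F) (F - σ)
  rw [sub_add_sub_cancel, hXF.eq, ← neg_sub σ F, Matrix.mul_neg, Matrix.trace_neg, map_neg] at key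
  have : RCLike.re ((X - F) * (σ - F)).trace = ((X - F) * (σ - F)).trace.re := rfl
  rw [norm_sub_rev F]
  rw [norm_neg] at key
  nlinarith [sq_nonneg ‖X - F‖]

/-- `X - F` is the negative part of `X`: it is orthogonal to `F` and pairs nonpositively with every
positive semidefinite matrix. This is the variational inequality of the projection onto the positive
cone. -/
theorem IsPositivePart.norm_sub_le {X F σ : Matrix (Fin d) (Fin d) ℂ} (h : IsPositivePart X F)
    (hσ : σ.PosSemidef) : ‖F - σ‖ ≤ ‖X - σ‖ := by
  obtain ⟨V, lam, hV, hX, hF⟩ := h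
  have hXF : X - F = V * Matrix.diagonal (fun i => ((min (lam i) 0 : ℝ) : ℂ)) * Vᴴ := by
    rw [hX, hF, ← Matrix.sub_mul, ← Matrix.mul_sub, Matrix.diagonal_sub]
    congr 3
    ext i
    rw [← Complex.ofReal_sub]
    congr 1
    linarith [min_add_max (lam i) 0]
  refine norm_sub_le_of_trace_nonpos (hXF ▸ isHermitian_unitary_diagonal V _) ?_
  rw [Matrix.mul_sub, Matrix.trace_sub, Complex.sub_re, hXF]
  conv_lhs => rw [hF]
  rw [trace_unitary_diagonal_mul_self hV]
  have h1 := trace_unitary_diagonal_mul_nonpos V hσ (w := fun i => min (lam i) 0)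
    (fun i => min_le_right _ _)
  have h2 : ∑ i, min (lam i) 0 * max (lam i) 0 = 0 :=
    Finset.sum_eq_zero fun i _ => by rw [min_mul_max, mul_zero]
  linarith

/-- Optimality conditions of the fast correction: `-τ` is the multiplier of the constraint on
the sum. -/
theorem IsFastCorrection.exists_multiplier {lam mu : Fin d → ℝ} (h : IsFastCorrection lam mu)
    (hlam : Antitone lam) :
    ∃ τ : ℝ, ∀ i, lam i - mu i + τ ≤ 0 ∧ (lam i - mu i + τ) * mu i = 0 := by
  obtain ⟨m, -, hlt, hmu⟩ := h
  set τ := (∑ k ∈ Finset.Ioi m, lam k) / ((m : ℕ) + 1 : ℝ) with hτ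
  refine ⟨τ, fun i => ?_⟩
  rw [hmu]
  split_ifs with hi
  · constructor
    · linarith
    · ring
  · refine ⟨?_, mul_zero _⟩
    rw [not_le] at hi
    have hm1 : (m : ℕ) + 1 < d := lt_of_le_of_lt hi i.isLt
    -- By monotonicity the first discarded index `m'` is the worst case. Its failed test, multiplied
    -- by its denominator `m + 2`, says exactly that `(lam m' + τ) * (m + 1) < 0`, because the entry
    -- `lam m'` moves out of the sum beyond `m`.
    set m' : Fin d := ⟨m + 1, hm1⟩ with hm'
    have hmm' : m < m' := Fin.lt_def.2 (Nat.lt_succ_self _)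
    have hsum : ∑ k ∈ Finset.Ioi m, lam k = lam m' + ∑ k ∈ Finset.Ioi m', lam k := by
      rw [← Finset.sum_insert (by simp)]
      congr 1
      ext k
      simp only [Finset.mem_Ioi, Finset.mem_insert, Fin.lt_def, Fin.ext_iff, hm']
      omega
    have h1 := hlt m' hmm'
    have hpos : (0 : ℝ) < (m : ℕ) + 1 := by positivity
    have hle : lam i ≤ lam m' := hlam (Fin.le_def.2 hi)
    have h2 : lam m' + τ ≤ 0 := by
      have hcast : ((m' : ℕ) : ℝ) = (m : ℕ) + 1 := by simp [hm']
      rw [hcast] at h1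
      have hpos' : (0 : ℝ) < (m : ℕ) + 1 + 1 := by positivity
      have h3 : lam m' * ((m : ℕ) + 1 + 1) + ∑ k ∈ Finset.Ioi m', lam k < 0 := by
        have := mul_neg_of_neg_of_pos h1 hpos'
        rwa [add_mul, div_mul_cancel₀ _ hpos'.ne'] at this
      have h4 : (lam m' + τ) * ((m : ℕ) + 1) < 0 := by
        rw [add_mul, hτ, div_mul_cancel₀ _ hpos.ne', hsum]
        linarith
      by_contra hc
      exact absurd h4 (not_lt.2 (mul_nonneg (not_le.1 hc).le hpos.le))
    linarith

/-- `σ - ρh` has trace zero, so adding `τ • 1` to `ρb - ρh` does not change their pairing. The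
shifted difference has nonpositive eigenvalues and is orthogonal to `ρh` by complementary slackness,
which gives the variational inequality. -/
theorem IsStateCorrection.norm_sub_le {ρb ρh σ : Matrix (Fin d) (Fin d) ℂ}
    (h : IsStateCorrection ρb ρh) (htr : ρb.trace = 1) (hσ : IsDensity σ) :
    ‖ρh - σ‖ ≤ ‖ρb - σ‖ := by
  obtain ⟨hdens, hcor⟩ := h
  obtain ⟨V, lam, mu, hV, hanti, hρb, hfast, hρh⟩ := hcor htr
  obtain ⟨τ, hτ⟩ := hfast.exists_multiplier hanti
  have hVV' : V * Vᴴ = 1 := Matrix.mem_unitaryGroup_iff.1 hV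
  have hdiff : ρb - ρh = V * Matrix.diagonal (fun i => ((lam i - mu i : ℝ) : ℂ)) * Vᴴ := by
    rw [hρb, hρh, ← Matrix.sub_mul, ← Matrix.mul_sub, Matrix.diagonal_sub]
    simp
  have hshift : ρb - ρh + (τ : ℂ) • 1 =
      V * Matrix.diagonal (fun i => ((lam i - mu i + τ : ℝ) : ℂ)) * Vᴴ := by
    have : (τ : ℂ) • (1 : Matrix (Fin d) (Fin d) ℂ) =
        V * Matrix.diagonal (fun _ => (τ : ℂ)) * Vᴴ := by
      rw [← Matrix.smul_one_eq_diagonal, Matrix.mul_smul, Matrix.mul_one, Matrix.smul_mul, hVV']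
    rw [hdiff, this, ← Matrix.add_mul, ← Matrix.mul_add, Matrix.diagonal_add]
    simp
  refine norm_sub_le_of_trace_nonpos (hdiff ▸ isHermitian_unitary_diagonal V _) ?_
  have htrace : (ρb - ρh) * (σ - ρh) =
      (ρb - ρh + (τ : ℂ) • 1) * (σ - ρh) - (τ : ℂ) • (σ - ρh) := by
    rw [Matrix.add_mul, Matrix.smul_mul, Matrix.one_mul, add_sub_cancel_right]
  rw [htrace, Matrix.trace_sub, Matrix.trace_smul, Matrix.trace_sub, hσ.2, hdens.2, sub_self,
    smul_zero, sub_zero, Matrix.mul_sub, Matrix.trace_sub, Complex.sub_re, hshift]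
  conv_lhs => rw [hρh]
  rw [trace_unitary_diagonal_mul_self hV]
  have h1 := trace_unitary_diagonal_mul_nonpos V hσ.1 (w := fun i => lam i - mu i + τ)
    (fun i => (hτ i).1)
  have h2 : ∑ i, (lam i - mu i + τ) * mu i = 0 := Finset.sum_eq_zero fun i _ => (hτ i).2
  linarith

/-- The 2-norm of the eigenvalues is at most their 1-norm. This yields the a priori bounds on
density operators and detectors that control records with large error. -/
theorem norm_le_trace_of_posSemidef {X : Matrix (Fin d) (Fin d) ℂ} (hX : X.PosSemidef) :
    ‖X‖ ≤ X.trace.re := by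
  have hspec := hX.1.spectral_theorem
  have htr := hX.1.trace_eq_sum_eigenvalues
  rw [Unitary.conjStarAlgAut_apply] at hspec
  have h1 : ‖X‖ = ‖Matrix.diagonal (fun i => (hX.1.eigenvalues i : ℂ))‖ := by
    conv_lhs => rw [hspec]
    rw [frobenius_norm_mul_unitary (Unitary.star_mem hX.1.eigenvectorUnitary.2),
      frobenius_norm_unitary_mul hX.1.eigenvectorUnitary.2]
    rfl
  rw [h1, htr]
  refine (frobenius_norm_le_sum _).trans_eq ?_
  simp only [Complex.re_sum]
  refine Finset.sum_congr rfl fun i _ => ?_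
  rw [Finset.sum_eq_single i]
  · simpa using hX.eigenvalues_nonneg i
  · intro j _ hj; simp [Matrix.diagonal_apply_ne _ hj.symm]
  · simp

theorem IsDensity.norm_le_one {ρ : Matrix (Fin d) (Fin d) ℂ} (h : IsDensity ρ) : ‖ρ‖ ≤ 1 := by
  simpa [h.2] using norm_le_trace_of_posSemidef h.1

theorem IsPOVM.norm_le {M : ℕ} {P : Fin M → Matrix (Fin d) (Fin d) ℂ} (h : IsPOVM P)
    (j : Fin M) : ‖P j‖ ≤ d := by
  refine (norm_le_trace_of_posSemidef (h.1 j)).trans ?_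
  have h1 : ∑ j, (P j).trace.re = d := by
    rw [← Complex.re_sum, ← Matrix.trace_sum, h.2]
    simp
  rw [← h1]
  exact Finset.single_le_sum (f := fun j => (P j).trace.re)
    (fun i _ => (Complex.le_def.1 (h.1 i).trace_nonneg).1) (Finset.mem_univ j)

/-- In `R * R - 1 = (R - 1) + R * (R - 1)` the two summands have nonnegative inner product since `R`
is positive semidefinite, so the second one can only increase the norm. -/
theorem norm_sqrt_sub_one_le {R : Matrix (Fin d) (Fin d) ℂ} (hR : R.PosSemidef) :
    ‖R - 1‖ ≤ ‖R * R - 1‖ := by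
  have h1 : R * R - 1 = (R - 1) + R * (R - 1) := by
    rw [Matrix.mul_sub, Matrix.mul_one]; abel
  refine le_of_sq_le_sq ?_ (norm_nonneg _)
  rw [h1, frobenius_norm_add_sq]
  have h2 : 0 ≤ RCLike.re ((R - 1)ᴴ * (R * (R - 1))).trace := by
    rw [← Matrix.mul_assoc]
    exact (Complex.le_def.1 (hR.conjTranspose_mul_mul_same (R - 1)).trace_nonneg).1
  nlinarith [sq_nonneg ‖R * (R - 1)‖]

theorem isUnit_det_of_norm_sub_one_lt {S : Matrix (Fin d) (Fin d) ℂ} (h : ‖S - 1‖ < 1) :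
    IsUnit S.det := by
  rw [← Matrix.isUnit_iff_isUnit_det]
  rw [norm_sub_rev] at h
  simpa using isUnit_one_sub_of_norm_lt_one h

/-- The detector correction is Lipschitz at a detector. -/
theorem IsDetectorCorrection.norm_sub_le {M : ℕ} {Pb Ph P : Fin M → Matrix (Fin d) (Fin d) ℂ}
    (h : IsDetectorCorrection Pb Ph) (hP : IsPOVM P) {e : ℝ} (he : M * e < 1)
    (hb : ∀ j, ‖Pb j - P j‖ ≤ e) (j : Fin M) :
    ‖Ph j - P j‖ ≤ (M * d * (2 + ‖(1 : Matrix (Fin d) (Fin d) ℂ)‖) + 1) * e := by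
  obtain ⟨hPOVM, F, hF, hcor⟩ := h
  have hFP : ∀ j, ‖F j - P j‖ ≤ e := fun j => ((hF j).norm_sub_le (hP.1 j)).trans (hb j)
  have hS : ‖∑ j, F j - 1‖ ≤ M * e := by
    rw [← hP.2, ← Finset.sum_sub_distrib]
    refine (norm_sum_le _ _).trans ((Finset.sum_le_sum fun j _ => hFP j).trans_eq ?_)
    simp
  obtain ⟨R, hR, hRR, hPh⟩ := hcor (isUnit_det_of_norm_sub_one_lt (hS.trans_lt he))
  have hR1 : ‖R - 1‖ ≤ M * e := (norm_sqrt_sub_one_le hR).trans (hRR ▸ hS)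
  have hRunit : IsUnit R.det := by
    have := isUnit_det_of_norm_sub_one_lt (hS.trans_lt he)
    rw [← hRR, Matrix.det_mul] at this
    exact isUnit_of_mul_isUnit_left this
  -- Working with this identity instead of the formula for `Ph j` avoids any bound on `R⁻¹`: `Ph j`
  -- is already bounded as an element of a detector.
  have hFj : R * Ph j * R = F j := by
    rw [hPh j, Matrix.mul_assoc, Matrix.mul_assoc, Matrix.nonsing_inv_mul _ hRunit,
      Matrix.mul_one, ← Matrix.mul_assoc, Matrix.mul_nonsing_inv _ hRunit, Matrix.one_mul]
  have hsplit : Ph j - P j = (1 - R) * Ph j + R * Ph j * (1 - R) + (F j - P j) := by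
    rw [Matrix.mul_sub, hFj, Matrix.sub_mul, Matrix.mul_one, Matrix.one_mul]
    abel
  have hQ := hPOVM.norm_le j
  have hRn : ‖R‖ ≤ 1 + ‖(1 : Matrix (Fin d) (Fin d) ℂ)‖ := by
    have := norm_add_le (R - 1) 1
    rw [sub_add_cancel] at this
    linarith
  have he0 : 0 ≤ e := (norm_nonneg _).trans (hb j)
  have hMe : 0 ≤ M * e := by positivity
  rw [norm_sub_rev] at hR1
  have h1 : ‖(1 - R) * Ph j‖ ≤ M * e * d :=
    (Matrix.frobenius_norm_mul _ _).trans (mul_le_mul hR1 hQ (norm_nonneg _) hMe)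
  have h2 : ‖R * Ph j * (1 - R)‖ ≤ (1 + ‖(1 : Matrix (Fin d) (Fin d) ℂ)‖) * d * (M * e) := by
    refine (Matrix.frobenius_norm_mul _ _).trans (mul_le_mul ?_ hR1 (norm_nonneg _) (by positivity))
    exact (Matrix.frobenius_norm_mul _ _).trans (mul_le_mul hRn hQ (norm_nonneg _) (by positivity))
  rw [hsplit]
  refine (norm_add₃_le).trans ?_
  calc _ ≤ M * e * d + (1 + ‖(1 : Matrix (Fin d) (Fin d) ℂ)‖) * d * (M * e) + e :=
        add_le_add_three h1 h2 (hFP j)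
    _ = _ := by ring

end Corrections

/-! ### First order error bounds -/

section ErrorBounds

open Filter Asymptotics Topology

variable {ι : Type*} {l : Filter ι} {e : ι → ℝ}

theorem isBigO_div_sub {𝕜 : Type*} [RCLike 𝕜] (he : Tendsto e l (𝓝 0)) {f g : ι → 𝕜} {a b : 𝕜}
    (hf : (fun i => f i - a) =O[l] e) (hg : (fun i => g i - b) =O[l] e) (hb : b ≠ 0) :
    (fun i => f i / g i - a / b) =O[l] e := by
  have hgt : Tendsto g l (𝓝 b) := tendsto_sub_nhds_zero_iff.1 (hg.trans_tendsto he)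
  have hinv : (fun i => (g i * b)⁻¹) =O[l] (fun _ => (1 : ℝ)) :=
    ((hgt.mul_const b).inv₀ (mul_ne_zero hb hb)).isBigO_one ℝ
  have hnum : (fun i => (f i - a) * b - a * (g i - b)) =O[l] e := by
    refine IsBigO.sub ?_ (hg.const_mul_left a)
    simpa only [mul_comm] using hf.const_mul_left b
  refine ((hnum.mul hinv).congr' ?_ (by simp))
  filter_upwards [hgt.eventually_ne hb] with i hi
  field_simp
  ring

theorem isBigO_mul_sub {𝕜 : Type*} [RCLike 𝕜] (he : Tendsto e l (𝓝 0)) {f g : ι → 𝕜} {a b : 𝕜}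
    (hf : (fun i => f i - a) =O[l] e) (hg : (fun i => g i - b) =O[l] e) :
    (fun i => f i * g i - a * b) =O[l] e := by
  have hgt : Tendsto g l (𝓝 b) := tendsto_sub_nhds_zero_iff.1 (hg.trans_tendsto he)
  have h1 : (fun i => (f i - a) * g i) =O[l] e := by
    simpa using hf.mul (hgt.isBigO_one ℝ)
  refine (h1.add (hg.const_mul_left a)).congr_left fun i => ?_
  ring

theorem isBigO_of_abs_le {E : Type*} [SeminormedAddCommGroup E] {f : ι → E}
    (h : ∀ i, ‖f i‖ ≤ e i) : f =O[l] e :=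
  IsBigO.of_bound 1 (Eventually.of_forall fun i => by
    rw [one_mul]; exact (h i).trans (le_abs_self _))

theorem isBigO_matrix {𝕜 : Type*} [RCLike 𝕜] {m n : Type*} [Fintype m] [Fintype n]
    {X : ι → Matrix m n 𝕜} (h : ∀ k k', (fun i => X i k k') =O[l] e) : X =O[l] e := by
  have h1 : (fun i => ∑ k, ∑ k', ‖X i k k'‖) =O[l] e :=
    IsBigO.fun_sum fun k _ => IsBigO.fun_sum fun k' _ => (h k k').norm_left
  exact (IsBigO.of_bound 1 (Eventually.of_forall fun i => by
    rw [one_mul]; exact (frobenius_norm_le_sum _).trans (le_abs_self _))).trans h1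

theorem isBigO_smul_const {m n : Type*} [Fintype m] [Fintype n] {c : ι → ℝ}
    (h : c =O[l] e) (X : Matrix m n ℂ) : (fun i => (c i : ℂ) • X) =O[l] e :=
  isBigO_matrix fun k k' => by
    simpa only [Matrix.smul_apply, smul_eq_mul, mul_comm] using
      (Complex.isBigO_ofReal_left.2 h).const_mul_left (X k k')

/-- Along `comap e (𝓝 0)` only small errors matter, and there the first-order bound applies. Where
`e i ≥ δ`, the uniform bound `C` is itself at most `C / δ * e i`. One constant thus serves all
indices, with no assumption on how often `e` is large. -/
theorem exists_sq_bound {f : ι → ℝ} (he : ∀ i, 0 ≤ e i) {C : ℝ} (hf : ∀ i, |f i| ≤ C)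
    (h : f =O[comap e (𝓝 0)] e) : ∃ K, ∀ i, f i ^ 2 ≤ K * e i ^ 2 := by
  obtain ⟨c, hc⟩ := h.bound
  rw [eventually_comap, Metric.eventually_nhds_iff] at hc
  obtain ⟨δ, hδ, hc⟩ := hc
  refine ⟨c ^ 2 + C ^ 2 / δ ^ 2, fun i => ?_⟩
  by_cases hi : e i < δ
  · have h1 := hc (y := e i) (by simpa [abs_of_nonneg (he i)] using hi) i rfl
    rw [Real.norm_eq_abs, Real.norm_eq_abs, abs_of_nonneg (he i)] at h1
    have h2 : f i ^ 2 ≤ (c * e i) ^ 2 := by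
      rw [← sq_abs]; exact pow_le_pow_left₀ (abs_nonneg _) h1 2
    have h3 : 0 ≤ C ^ 2 / δ ^ 2 * e i ^ 2 := by positivity
    nlinarith
  · have h1 : f i ^ 2 ≤ C ^ 2 := by
      rw [← sq_abs]; exact pow_le_pow_left₀ (abs_nonneg _) (hf i) 2
    have h2 : δ ^ 2 ≤ e i ^ 2 := pow_le_pow_left₀ hδ.le (not_lt.1 hi) 2
    have h3 : C ^ 2 ≤ C ^ 2 / δ ^ 2 * e i ^ 2 := by
      rw [div_mul_eq_mul_div, le_div_iff₀ (by positivity)]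
      exact mul_le_mul_of_nonneg_left h2 (sq_nonneg _)
    have h4 : 0 ≤ c ^ 2 * e i ^ 2 := by positivity
    nlinarith

theorem StateChoice.isBigO_combine_sub {M : ℕ} (hM : M ≠ 0) (ch : StateChoice M) {E : Type*}
    [NormedAddCommGroup E] [NormedSpace ℝ E] {v : ι → Fin M → E} {v₀ : E}
    (h : ∀ j, ch.Uses j → (fun i => v i j - v₀) =O[l] e) :
    (fun i => ch.combine (v i) - v₀) =O[l] e := by
  cases ch with
  | single j => exact h j rfl
  | average =>
    have h1 : (fun i => ∑ j, (v i j - v₀)) =O[l] e := IsBigO.fun_sum fun j _ => h j trivial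
    refine (h1.const_smul_left (1 / M : ℝ)).congr_left fun i => ?_
    have hM' : (M : ℝ) ≠ 0 := Nat.cast_ne_zero.2 hM
    simp only [StateChoice.combine, Finset.sum_sub_distrib, smul_sub, Finset.sum_const,
      Finset.card_univ, Fintype.card_fin, ← Nat.cast_smul_eq_nsmul ℝ M v₀, smul_smul,
      one_div_mul_cancel hM', one_smul, Pi.smul_apply]

theorem isUnit_det_conjTranspose_mul_self {𝕜 : Type*} [RCLike 𝕜] {m n : Type*} [Fintype m]
    [Fintype n] [DecidableEq n] {B : Matrix m n 𝕜} (hB : B.rank = Fintype.card n) :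
    IsUnit (Bᴴ * B).det := by
  have h : (Bᴴ * B).rank = Fintype.card n := by
    classical exact (Matrix.rank_conjTranspose_mul_self B).trans hB
  rw [← Matrix.isUnit_iff_isUnit_det, ← Matrix.mulVec_surjective_iff_isUnit]
  have h2 : Module.finrank 𝕜 (LinearMap.range (Bᴴ * B).mulVecLin) =
      Module.finrank 𝕜 (n → 𝕜) := by
    rw [Module.finrank_pi]; exact h
  exact LinearMap.range_eq_top.1 (Submodule.eq_top_of_finrank_eq h2)

/-- The Kronecker factors obtained from perturbed data, up to their free scalar. -/
theorem isBigO_svdFactor {𝕜 : Type*} [RCLike 𝕜] {m n : Type*} [Fintype m] [Fintype n]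
    [DecidableEq n] {B : Matrix m (n × n) 𝕜} (hB : B.rank = Fintype.card (n × n))
    {Y : ι → m → 𝕜} {x c : ι → n → 𝕜} (h : ∀ i, IsSVDFactor (leastSquares B (Y i)) (x i) (c i))
    (a b : n → 𝕜) (hY : ∀ q, (fun i => Y i q - (B *ᵥ fun p => a p.1 * b p.2) q) =O[l] e)
    (k k' : n) : (fun i => x i k * c i k' - a k * b k') =O[l] e := by
  set z : n × n → 𝕜 := fun p => a p.1 * b p.2 with hz
  set G := (Bᴴ * B)⁻¹ * Bᴴ with hG
  have hLS : ∀ i p, leastSquares B (Y i) p - z p = ∑ q, G p q * (Y i q - (B *ᵥ z) q) := by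
    intro i p
    -- `G` is a left inverse of `B`, so the exact data return `z` and the error is `G` applied to
    -- the data error.
    have h1 : leastSquares B (Y i) - z = G *ᵥ (Y i - B *ᵥ z) := by
      rw [Matrix.mulVec_sub, Matrix.mulVec_mulVec, hG, Matrix.mul_assoc,
        Matrix.nonsing_inv_mul _ (isUnit_det_conjTranspose_mul_self hB), Matrix.one_mulVec,
        leastSquares, Matrix.mulVec_mulVec]
    exact congrFun h1 p
  have h1 : (fun i => Matrix.of (fun k l => leastSquares B (Y i) (k, l)) -
      Matrix.vecMulVec a b) =O[l] e := by
    refine isBigO_matrix fun k k' => ?_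
    have : (fun i => ∑ q, G (k, k') q * (Y i q - (B *ᵥ z) q)) =O[l] e :=
      IsBigO.fun_sum fun q _ => (hY q).const_mul_left _
    refine this.congr_left fun i => ?_
    rw [← hLS]
    rfl
  refine IsBigO.trans (IsBigO.of_bound 2 (Eventually.of_forall fun i => ?_)) h1
  exact (norm_apply_le (Matrix.vecMulVec (x i) (c i) - Matrix.vecMulVec a b) k k').trans
    ((h i).norm_vecMulVec_sub_le a b)

theorem isBigO_stateCorrection {d : ℕ} {ρb ρh : ι → Matrix (Fin d) (Fin d) ℂ}
    {ρ₀ : Matrix (Fin d) (Fin d) ℂ} (hρ₀ : IsDensity ρ₀)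
    (h : ∀ i, IsStateCorrection (ρb i) (ρh i)) (htr : ∀ᶠ i in l, (ρb i).trace = 1)
    (hb : (fun i => ρb i - ρ₀) =O[l] e) : (fun i => ‖ρh i - ρ₀‖) =O[l] e := by
  refine IsBigO.trans (IsBigO.of_bound 1 ?_) hb
  filter_upwards [htr] with i hi
  rw [one_mul, norm_norm]
  exact (h i).norm_sub_le hi hρ₀

theorem isBigO_detectorCorrection {d M : ℕ} (he : Tendsto e l (𝓝 0))
    {Pb Ph : ι → Fin M → Matrix (Fin d) (Fin d) ℂ}
    {P : Fin M → Matrix (Fin d) (Fin d) ℂ} (hP : IsPOVM P)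
    (h : ∀ i, IsDetectorCorrection (Pb i) (Ph i))
    (hb : ∀ j, (fun i => Pb i j - P j) =O[l] e) (j : Fin M) :
    (fun i => ‖Ph i j - P j‖) =O[l] e := by
  -- The Lipschitz bound wants one number that dominates the errors of all outcomes. Their sum does,
  -- and `M` times it is eventually below 1.
  have hsum : (fun i => ∑ j, ‖Pb i j - P j‖) =O[l] e := IsBigO.fun_sum fun j _ => (hb j).norm_left
  have ht : Tendsto (fun i => M * ∑ j, ‖Pb i j - P j‖) l (𝓝 0) := by
    simpa using (hsum.trans_tendsto he).const_mul (M : ℝ)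
  refine IsBigO.trans (IsBigO.of_bound
    (M * d * (2 + ‖(1 : Matrix (Fin d) (Fin d) ℂ)‖) + 1) ?_) hsum
  filter_upwards [ht.eventually_lt_const one_pos] with i hi
  rw [norm_norm, Real.norm_of_nonneg (by positivity)]
  exact (h i).norm_sub_le hP hi (fun j => Finset.single_le_sum
    (f := fun j => ‖Pb i j - P j‖) (fun _ _ => norm_nonneg _) (Finset.mem_univ j)) j

end ErrorBounds

/-! ### The linear equations satisfied by the exact data -/

section ExactData

variable {d : ℕ}

theorem naturalMatrix_mulVec_vec (A : Fin (d ^ 2) → Matrix (Fin d) (Fin d) ℂ)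
    (X : Matrix (Fin d) (Fin d) ℂ) :
    naturalMatrix A *ᵥ Matrix.vec X = Matrix.vec (applyKraus A X) := by
  rw [naturalMatrix, applyKraus, Matrix.vec_sum, Matrix.sum_mulVec]
  refine Finset.sum_congr rfl fun i _ => ?_
  rw [Matrix.kronecker_mulVec_vec]
  rfl

/-- `Tr (P σ)` is the plain dot product of `vec Pᵀ` and `vec σ`, and `vec σ` is the natural matrix
applied to `vec ρ`. Column stacking puts the input index first, so the state is the first Kronecker
factor. -/
theorem designNatural_mulVec {L : ℕ} (A : Fin L → Fin (d ^ 2) → Matrix (Fin d) (Fin d) ℂ)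
    (ρ P : Matrix (Fin d) (Fin d) ℂ) (a : Fin L) :
    (designNatural A *ᵥ fun p => Matrix.vec ρ p.1 * Matrix.vec Pᵀ p.2) a =
      (P * applyKraus (A a) ρ).trace := by
  have h : (P * applyKraus (A a) ρ).trace =
      Matrix.vec Pᵀ ⬝ᵥ Matrix.vec (applyKraus (A a) ρ) := by
    rw [Matrix.vec_dotProduct_vec, Matrix.transpose_transpose]
  rw [h, ← naturalMatrix_mulVec_vec]
  simp only [designNatural, Matrix.mulVec, dotProduct, Matrix.of_apply, Matrix.vec,
    Finset.mul_sum]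
  rw [Fintype.sum_prod_type, Finset.sum_comm]
  refine Finset.sum_congr rfl fun q _ => Finset.sum_congr rfl fun p _ => ?_
  ring

theorem trace_mul_im_eq_zero {X Y : Matrix (Fin d) (Fin d) ℂ} (hX : X.IsHermitian)
    (hY : Y.IsHermitian) : (X * Y).trace.im = 0 := by
  have h : star (X * Y).trace = (X * Y).trace := by
    rw [← Matrix.trace_conjTranspose, Matrix.conjTranspose_mul, hX.eq, hY.eq,
      Matrix.trace_mul_comm]
  exact Complex.conj_eq_iff_im.1 h

theorem trace_mul_eq_ofReal {X Y : Matrix (Fin d) (Fin d) ℂ} (hX : X.IsHermitian)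
    (hY : Y.IsHermitian) : (X * Y).trace = ((X * Y).trace.re : ℂ) :=
  Complex.ext rfl (by simpa using trace_mul_im_eq_zero hX hY)

theorem trace_eq_ofReal {X : Matrix (Fin d) (Fin d) ℂ} (hX : X.IsHermitian) :
    X.trace = (X.trace.re : ℂ) := by
  simpa using trace_mul_eq_ofReal hX Matrix.isHermitian_one

theorem posSemidef_applyKraus (A : Fin (d ^ 2) → Matrix (Fin d) (Fin d) ℂ)
    {X : Matrix (Fin d) (Fin d) ℂ} (hX : X.PosSemidef) : (applyKraus A X).PosSemidef :=
  Matrix.posSemidef_sum _ fun i _ => hX.mul_mul_conjTranspose_same (A i)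

theorem basisChange_mul_conjTranspose (hd : d ≠ 0)
    {Ω : Fin (d ^ 2 - 1) → Matrix (Fin d) (Fin d) ℂ} (hΩ : IsTracelessBasis Ω) :
    basisChange Ω * (basisChange Ω)ᴴ = 1 := by
  have hentry : ∀ k l, (basisChange Ω * (basisChange Ω)ᴴ) k l =
      ((fullBasis Ω k)ᴴ * fullBasis Ω l).trace := by
    intro k l
    rw [← Matrix.star_vec_dotProduct_vec]
    simp [Matrix.mul_apply, basisChange, dotProduct]
  have hsq : ((1 / Real.sqrt d : ℝ) : ℂ) * ((1 / Real.sqrt d : ℝ) : ℂ) * d = 1 := by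
    have hd' : (0 : ℝ) < d := by positivity
    have : (1 / Real.sqrt d) * (1 / Real.sqrt d) * d = 1 := by
      rw [div_mul_div_comm, Real.mul_self_sqrt hd'.le, one_mul, one_div_mul_cancel hd'.ne']
    exact_mod_cast this
  ext k l
  rw [hentry]
  cases k with
  | none =>
    cases l with
    | none => simpa [fullBasis, mul_assoc] using hsq
    | some l => simp [fullBasis, hΩ.trace_zero l]
  | some k =>
    cases l with
    | none => simp [fullBasis, Matrix.trace_conjTranspose, hΩ.trace_zero k]
    | some l => simpa [fullBasis, Matrix.one_apply] using hΩ.orthonormal k l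

/-- The two index types have the same cardinality `1 + (d ^ 2 - 1) = d ^ 2`, so a one-sided inverse
is two-sided. This is completeness of the operator basis. -/
theorem conjTranspose_mul_basisChange (hd : d ≠ 0)
    {Ω : Fin (d ^ 2 - 1) → Matrix (Fin d) (Fin d) ℂ} (hΩ : IsTracelessBasis Ω) :
    (basisChange Ω)ᴴ * basisChange Ω = 1 := by
  have hcard : Fintype.card (Option (Fin (d ^ 2 - 1))) = Fintype.card (Fin d × Fin d) := by
    have : 0 < d ^ 2 := by positivity
    simp only [Fintype.card_option, Fintype.card_fin, Fintype.card_prod]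
    rw [Nat.sub_add_cancel this, sq]
  exact (Matrix.mul_eq_one_comm_of_card_eq _ _ _ hcard).1 (basisChange_mul_conjTranspose hd hΩ)

/-- Expansion of a Hermitian matrix in the orthonormal basis. -/
theorem IsTracelessBasis.expansion (hd : d ≠ 0) {Ω : Fin (d ^ 2 - 1) → Matrix (Fin d) (Fin d) ℂ}
    (hΩ : IsTracelessBasis Ω) {X : Matrix (Fin d) (Fin d) ℂ} (hX : X.IsHermitian) :
    X = ((X.trace.re / Real.sqrt d : ℝ) : ℂ) • fullBasis Ω none +
      ∑ k, (coeff Ω X k : ℂ) • Ω k := by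
  have hcoef : ∀ k, (basisChange Ω *ᵥ Matrix.vec X) k = ((fullBasis Ω k)ᴴ * X).trace := by
    intro k
    rw [← Matrix.star_vec_dotProduct_vec]
    rfl
  have hnone : (basisChange Ω *ᵥ Matrix.vec X) none = ((X.trace.re / Real.sqrt d : ℝ) : ℂ) := by
    rw [hcoef]
    simp only [fullBasis, Matrix.conjTranspose_smul, Matrix.conjTranspose_one, Matrix.smul_mul,
      Matrix.one_mul, Matrix.trace_smul]
    rw [trace_eq_ofReal hX]
    simp [div_eq_mul_inv, mul_comm]
  have hsome : ∀ k, (basisChange Ω *ᵥ Matrix.vec X) (some k) = (coeff Ω X k : ℂ) := by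
    intro k
    rw [hcoef]
    simp only [fullBasis, (hΩ.herm k).eq]
    exact trace_mul_eq_ofReal (hΩ.herm k) hX
  have hvec : Matrix.vec X = (basisChange Ω)ᴴ *ᵥ (basisChange Ω *ᵥ Matrix.vec X) := by
    rw [Matrix.mulVec_mulVec, conjTranspose_mul_basisChange hd hΩ, Matrix.one_mulVec]
  apply Matrix.vec_inj.1
  rw [hvec]
  ext p
  rw [Matrix.mulVec, dotProduct, Fintype.sum_option, hnone]
  simp only [hsome]
  simp only [Matrix.vec_add, Matrix.vec_smul, Matrix.vec_sum, Pi.add_apply, Pi.smul_apply,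
    Finset.sum_apply, smul_eq_mul, Matrix.conjTranspose_apply, basisChange, Matrix.of_apply,
    star_star, fullBasis]
  simp only [mul_comm]

theorem tracelessBlock_apply (Ω : Fin (d ^ 2 - 1) → Matrix (Fin d) (Fin d) ℂ)
    (hΩ : IsTracelessBasis Ω) (A : Fin (d ^ 2) → Matrix (Fin d) (Fin d) ℂ)
    (k l : Fin (d ^ 2 - 1)) :
    tracelessBlock Ω A k l = coeff Ω (applyKraus A (Ω l)) k := by
  have h : (basisChange Ω * naturalMatrix A * (basisChange Ω)ᴴ) (some k) (some l) =
      (basisChange Ω *ᵥ (naturalMatrix A *ᵥ Matrix.vec (Ω l))) (some k) := by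
    rw [Matrix.mulVec_mulVec, Matrix.mul_apply]
    simp [Matrix.mulVec, dotProduct, basisChange, fullBasis]
  rw [tracelessBlock, Matrix.of_apply, h, naturalMatrix_mulVec_vec, coeff]
  congr 1
  rw [← (hΩ.herm k).eq, ← Matrix.star_vec_dotProduct_vec]
  simp [Matrix.mulVec, dotProduct, basisChange, fullBasis]

theorem applyKraus_add (A : Fin (d ^ 2) → Matrix (Fin d) (Fin d) ℂ)
    (X Y : Matrix (Fin d) (Fin d) ℂ) :
    applyKraus A (X + Y) = applyKraus A X + applyKraus A Y := by
  simp [applyKraus, Matrix.mul_add, Matrix.add_mul, Finset.sum_add_distrib]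

theorem applyKraus_smul (A : Fin (d ^ 2) → Matrix (Fin d) (Fin d) ℂ) (c : ℂ)
    (X : Matrix (Fin d) (Fin d) ℂ) : applyKraus A (c • X) = c • applyKraus A X := by
  simp [applyKraus, Finset.smul_sum]

theorem applyKraus_sum (A : Fin (d ^ 2) → Matrix (Fin d) (Fin d) ℂ) {κ : Type*} (s : Finset κ)
    (X : κ → Matrix (Fin d) (Fin d) ℂ) :
    applyKraus A (∑ k ∈ s, X k) = ∑ k ∈ s, applyKraus A (X k) := by
  simp only [applyKraus, Matrix.mul_sum, Matrix.sum_mul]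
  exact Finset.sum_comm

/-- The identity component of `X` is sent to a multiple of the identity, which is orthogonal to
every `Ω k`. Hence the traceless block alone determines the traceless coefficients of the output. -/
theorem coeff_applyKraus (hd : d ≠ 0) {Ω : Fin (d ^ 2 - 1) → Matrix (Fin d) (Fin d) ℂ}
    (hΩ : IsTracelessBasis Ω) {A : Fin (d ^ 2) → Matrix (Fin d) (Fin d) ℂ}
    (hA : IsGeneralizedUnital A) {X : Matrix (Fin d) (Fin d) ℂ} (hX : X.IsHermitian)
    (k : Fin (d ^ 2 - 1)) :
    coeff Ω (applyKraus A X) k = ∑ l, tracelessBlock Ω A k l * coeff Ω X l := by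
  obtain ⟨α, -, -, hα⟩ := hA
  simp only [tracelessBlock_apply Ω hΩ]
  conv_lhs => rw [hΩ.expansion hd hX]
  simp only [applyKraus_add, applyKraus_sum, applyKraus_smul, fullBasis, hα, coeff,
    Matrix.mul_add, Matrix.mul_sum, Matrix.mul_smul, Matrix.mul_one, Matrix.trace_add,
    Matrix.trace_sum, Matrix.trace_smul, hΩ.trace_zero, smul_eq_mul, mul_zero, zero_add,
    Complex.re_sum, Complex.re_ofReal_mul]
  simp only [mul_comm]

/-- Parseval splits `Tr (P σ)` into the product of the identity components and a sum over traceless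
coefficients. By `coeff_applyKraus` that sum is bilinear in the traceless coefficients of `ρ` and
`P`. -/
theorem designB_mulVec {L : ℕ} (hd : d ≠ 0) {Ω : Fin (d ^ 2 - 1) → Matrix (Fin d) (Fin d) ℂ}
    (hΩ : IsTracelessBasis Ω) {A : Fin L → Fin (d ^ 2) → Matrix (Fin d) (Fin d) ℂ}
    (hA : ∀ a, IsGeneralizedUnital (A a)) {ρ P : Matrix (Fin d) (Fin d) ℂ}
    (hρ : ρ.IsHermitian) (hP : P.IsHermitian) (a : Fin L) :
    (designB Ω A *ᵥ fun p => coeff Ω ρ p.1 * coeff Ω P p.2) a =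
      (P * applyKraus (A a) ρ).trace.re -
        (applyKraus (A a) ρ).trace.re / Real.sqrt d * (P.trace.re / Real.sqrt d) := by
  have h1 : (P * applyKraus (A a) ρ).trace.re =
      (applyKraus (A a) ρ).trace.re / Real.sqrt d * (P.trace.re / Real.sqrt d) +
        ∑ k, coeff Ω P k * coeff Ω (applyKraus (A a) ρ) k := by
    conv_lhs => rw [hΩ.expansion hd hP]
    simp only [fullBasis, coeff, Matrix.add_mul, Matrix.sum_mul, Matrix.smul_mul, Matrix.one_mul,
      Matrix.trace_add, Matrix.trace_sum, Matrix.trace_smul, smul_eq_mul, Complex.add_re,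
      Complex.re_sum, Complex.re_ofReal_mul]
    ring
  rw [h1, add_sub_cancel_left]
  simp only [coeff_applyKraus hd hΩ (hA a) hρ, designB, Matrix.mulVec, dotProduct,
    Matrix.of_apply, Matrix.vec, Fintype.sum_prod_type, Finset.mul_sum]
  rw [Finset.sum_comm]
  refine Finset.sum_congr rfl fun k _ => Finset.sum_congr rfl fun l _ => ?_
  ring

end ExactData

/-! ### Mean square errors of relative frequencies and averages -/

section Sampling

variable {κ α : Type*} [Fintype κ] [DecidableEq κ] [Fintype α]

theorem sum_prod_eq_prod_sum (f : κ → α → ℝ) :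
    ∑ r : κ → α, ∏ a, f a (r a) = ∏ a, ∑ x, f a x := by
  rw [Finset.prod_univ_sum, Fintype.piFinset_univ]

theorem sum_prod_mul_apply (q : κ → α → ℝ) (hq : ∀ a, ∑ x, q a x = 1) (i : κ) (f : α → ℝ) :
    ∑ r : κ → α, (∏ a, q a (r a)) * f (r i) = ∑ x, q i x * f x := by
  -- Writing `f (r i)` as a product over all coordinates, with factor 1 away from `i`, lets the sum
  -- over `r` factor.
  have h : ∀ r : κ → α, (∏ a, q a (r a)) * f (r i) =
      ∏ a, q a (r a) * (if a = i then f (r a) else 1) := by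
    intro r
    rw [Finset.prod_mul_distrib, Finset.prod_ite_eq' Finset.univ i (fun a => f (r a))]
    simp
  simp only [h]
  rw [sum_prod_eq_prod_sum (fun a x => q a x * (if a = i then f x else 1)),
    Finset.prod_eq_single i]
  · simp
  · intro b _ hb; simp [hb, hq]
  · simp

/-- Independence: for `i ≠ j` the sum factors over coordinates, and the factor at `i` is the mean of
`f`, which is zero. -/
theorem sum_prod_mul_apply_mul_apply (q : κ → α → ℝ) (i j : κ) (hij : i ≠ j) (f : α → ℝ)
    (hf : ∑ x, q i x * f x = 0) :
    ∑ r : κ → α, (∏ a, q a (r a)) * (f (r i) * f (r j)) = 0 := by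
  have h : ∀ r : κ → α, (∏ a, q a (r a)) * (f (r i) * f (r j)) =
      ∏ a, q a (r a) * ((if a = i then f (r a) else 1) * (if a = j then f (r a) else 1)) := by
    intro r
    rw [Finset.prod_mul_distrib, Finset.prod_mul_distrib,
      Finset.prod_ite_eq' Finset.univ i (fun a => f (r a)),
      Finset.prod_ite_eq' Finset.univ j (fun a => f (r a))]
    simp
  simp only [h]
  rw [sum_prod_eq_prod_sum (fun a x => q a x * ((if a = i then f x else 1) *
    (if a = j then f x else 1)))]
  refine Finset.prod_eq_zero (Finset.mem_univ i) ?_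
  simpa [hij] using hf

theorem sum_seqProb {n : ℕ} {p : α → ℝ} (hp : ∑ x, p x = 1) :
    ∑ s : Fin n → α, seqProb p s = 1 := by
  unfold seqProb
  rw [sum_prod_eq_prod_sum (fun _ => p)]
  simp [hp]

theorem seqProb_nonneg {α : Type*} {n : ℕ} {p : α → ℝ} (hp : ∀ x, 0 ≤ p x) (s : Fin n → α) :
    0 ≤ seqProb p s :=
  Finset.prod_nonneg fun _ _ => hp _

/-- The mean square error of the average of `n` independent observations. -/
theorem sum_seqProb_mul_average_sub_sq {n : ℕ} (hn : 0 < n) {p : α → ℝ} (hp : ∑ x, p x = 1)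
    (g : α → ℝ) {μ : ℝ} (hμ : ∑ x, p x * g x = μ) :
    ∑ s : Fin n → α, seqProb p s * ((∑ i, g (s i)) / n - μ) ^ 2 =
      (∑ x, p x * (g x - μ) ^ 2) / n := by
  have hn' : (n : ℝ) ≠ 0 := by positivity
  have hzero : ∑ x, p x * (g x - μ) = 0 := by
    simp only [mul_sub, Finset.sum_sub_distrib, hμ, ← Finset.sum_mul, hp, one_mul, sub_self]
  have hexp : ∀ s : Fin n → α, seqProb p s * ((∑ i, g (s i)) / n - μ) ^ 2 =
      (∑ i, ∑ j, (∏ k, p (s k)) * ((g (s i) - μ) * (g (s j) - μ))) / (n : ℝ) ^ 2 := by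
    intro s
    have h1 : (∑ i, g (s i)) / n - μ = (∑ i, (g (s i) - μ)) / n := by
      rw [Finset.sum_sub_distrib]
      simp
      field_simp
    rw [h1, div_pow, sq (∑ i, _), Finset.sum_mul_sum, mul_div_assoc', Finset.mul_sum, seqProb]
    simp only [Finset.mul_sum]
  simp only [hexp, ← Finset.sum_div]
  rw [Finset.sum_comm]
  -- Of the double sum only the diagonal survives; the other terms are covariances of independent
  -- centred variables.
  have hrow : ∀ i : Fin n, ∑ s : Fin n → α, ∑ j, (∏ k, p (s k)) * ((g (s i) - μ) * (g (s j) - μ)) =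
      ∑ x, p x * (g x - μ) ^ 2 := by
    intro i
    rw [Finset.sum_comm, Finset.sum_eq_single i]
    · simp only [← sq]
      exact sum_prod_mul_apply (fun _ => p) (fun _ => hp) i (fun x => (g x - μ) ^ 2)
    · intro j _ hj
      exact sum_prod_mul_apply_mul_apply (fun _ => p) i j hj.symm (fun x => g x - μ) hzero
    · simp
  simp only [hrow, Finset.sum_const, Finset.card_univ, Fintype.card_fin, nsmul_eq_mul]
  field_simp

/-- A relative frequency is the average of an indicator, whose deviation from its mean never exceeds
1 in absolute value. -/
theorem sum_seqProb_mul_freq_sub_sq_le {n : ℕ} (hn : 0 < n) {p : α → ℝ} (hp0 : ∀ x, 0 ≤ p x)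
    (hp : ∑ x, p x = 1) (y : α) :
    ∑ s : Fin n → α, seqProb p s * (freq s y - p y) ^ 2 ≤ 1 / n := by
  classical
  have hμ : ∑ x, p x * (if x = y then (1 : ℝ) else 0) = p y := by simp
  have h := sum_seqProb_mul_average_sub_sq hn hp (fun x => if x = y then (1 : ℝ) else 0) hμ
  have hfreq : ∀ s : Fin n → α, freq s y = (∑ i, if s i = y then (1 : ℝ) else 0) / n := by
    intro s
    rw [freq, Finset.sum_boole]
  simp only [hfreq]
  rw [h]
  gcongr
  calc ∑ x, p x * ((if x = y then (1 : ℝ) else 0) - p y) ^ 2 ≤ ∑ x, p x * 1 := by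
        refine Finset.sum_le_sum fun x _ => mul_le_mul_of_nonneg_left ?_ (hp0 x)
        have h1 : p y ≤ 1 := hp ▸ Finset.single_le_sum (fun x _ => hp0 x) (Finset.mem_univ y)
        have h0 := hp0 y
        split_ifs <;> nlinarith
    _ = 1 := by simp [hp]

end Sampling

/-! ### Born's rule gives probability distributions -/

section Born

variable {d M : ℕ}

theorem trace_mul_re_nonneg {X Y : Matrix (Fin d) (Fin d) ℂ} (hX : X.PosSemidef)
    (hY : Y.PosSemidef) : 0 ≤ (X * Y).trace.re := by
  have hspec := hX.1.spectral_theorem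
  rw [Unitary.conjStarAlgAut_apply] at hspec
  have h := trace_unitary_diagonal_mul_nonpos (hX.1.eigenvectorUnitary : Matrix (Fin d) (Fin d) ℂ)
    hY (w := fun i => -hX.1.eigenvalues i) (fun i => neg_nonpos.2 (hX.eigenvalues_nonneg i))
  have h2 : (hX.1.eigenvectorUnitary : Matrix (Fin d) (Fin d) ℂ) *
      Matrix.diagonal (fun i => ((-hX.1.eigenvalues i : ℝ) : ℂ)) *
      (hX.1.eigenvectorUnitary : Matrix (Fin d) (Fin d) ℂ)ᴴ = -X := by
    conv_rhs => rw [hspec]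
    rw [← Matrix.neg_mul, ← Matrix.mul_neg, Matrix.diagonal_neg]
    simp only [Complex.ofReal_neg]
    rfl
  rw [h2, Matrix.neg_mul, Matrix.trace_neg, Complex.neg_re] at h
  linarith

theorem trace_applyKraus (A : Fin (d ^ 2) → Matrix (Fin d) (Fin d) ℂ)
    (ρ : Matrix (Fin d) (Fin d) ℂ) :
    (applyKraus A ρ).trace = ((∑ i, (A i)ᴴ * A i) * ρ).trace := by
  rw [applyKraus, Finset.sum_mul, Matrix.trace_sum, Matrix.trace_sum]
  refine Finset.sum_congr rfl fun i _ => ?_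
  rw [Matrix.trace_mul_comm, Matrix.mul_assoc]

/-- The loss probability is the trace of `(1 - ∑ i, (A i)ᴴ * A i) * ρ`, a product of two positive
semidefinite matrices. -/
theorem trace_applyKraus_re_le_one {A : Fin (d ^ 2) → Matrix (Fin d) (Fin d) ℂ}
    (hA : IsProcess A) {ρ : Matrix (Fin d) (Fin d) ℂ} (hρ : IsDensity ρ) :
    (applyKraus A ρ).trace.re ≤ 1 := by
  have h := trace_mul_re_nonneg hA hρ.1
  rw [Matrix.sub_mul, Matrix.one_mul, Matrix.trace_sub, hρ.2, ← trace_applyKraus] at h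
  simpa using h

theorem trace_applyKraus_of_isTP {A : Fin (d ^ 2) → Matrix (Fin d) (Fin d) ℂ}
    (hA : IsTP A) (ρ : Matrix (Fin d) (Fin d) ℂ) : (applyKraus A ρ).trace = ρ.trace := by
  rw [trace_applyKraus, hA, Matrix.one_mul]

theorem detectProb_nonneg {P : Fin M → Matrix (Fin d) (Fin d) ℂ} (hP : IsPOVM P)
    {σ : Matrix (Fin d) (Fin d) ℂ} (hσ : σ.PosSemidef) (h1 : σ.trace.re ≤ 1) :
    ∀ x, 0 ≤ detectProb P σ x
  | some j => trace_mul_re_nonneg (hP.1 j) hσ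
  | none => sub_nonneg.2 h1

theorem sum_detectProb {P : Fin M → Matrix (Fin d) (Fin d) ℂ} (hP : IsPOVM P)
    (σ : Matrix (Fin d) (Fin d) ℂ) : ∑ x, detectProb P σ x = 1 := by
  rw [Fintype.sum_option]
  simp only [detectProb]
  rw [← Complex.re_sum, ← Matrix.trace_sum, ← Finset.sum_mul, hP.2, Matrix.one_mul,
    sub_add_cancel]

theorem identityProb_nonneg {σ : Matrix (Fin d) (Fin d) ℂ} (hσ : σ.PosSemidef)
    (h1 : σ.trace.re ≤ 1) : ∀ x, 0 ≤ identityProb σ x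
  | true => (Complex.le_def.1 hσ.trace_nonneg).1
  | false => sub_nonneg.2 h1

theorem sum_identityProb (σ : Matrix (Fin d) (Fin d) ℂ) : ∑ x, identityProb σ x = 1 := by
  simp [identityProb]

theorem mixedProb_eq (P : Fin M → Matrix (Fin d) (Fin d) ℂ) (j : Fin M) :
    mixedProb P j = (P j).trace.re / d := by
  rw [mixedProb, Matrix.mul_smul, Matrix.mul_one, Matrix.trace_smul, smul_eq_mul,
    Complex.re_ofReal_mul]
  ring

theorem mixedProb_nonneg {P : Fin M → Matrix (Fin d) (Fin d) ℂ} (hP : IsPOVM P) (j : Fin M) :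
    0 ≤ mixedProb P j := by
  rw [mixedProb_eq]
  exact div_nonneg (Complex.le_def.1 (hP.1 j).trace_nonneg).1 (Nat.cast_nonneg _)

theorem sum_mixedProb (hd : d ≠ 0) {P : Fin M → Matrix (Fin d) (Fin d) ℂ} (hP : IsPOVM P) :
    ∑ j, mixedProb P j = 1 := by
  simp only [mixedProb_eq]
  rw [← Finset.sum_div, ← Complex.re_sum, ← Matrix.trace_sum, hP.2]
  simp [hd]

theorem observableProb_nonneg {O ρ : Matrix (Fin d) (Fin d) ℂ} (hO : O.IsHermitian)
    (hρ : ρ.PosSemidef) (i : Fin d) : 0 ≤ observableProb hO ρ i :=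
  (Complex.le_def.1 ((hρ.conjTranspose_mul_mul_same _).diag_nonneg (i := i))).1

theorem sum_observableProb {O ρ : Matrix (Fin d) (Fin d) ℂ} (hO : O.IsHermitian)
    (hρ : IsDensity ρ) : ∑ i, observableProb hO ρ i = 1 := by
  have hUU : (hO.eigenvectorUnitary : Matrix (Fin d) (Fin d) ℂ) *
      (hO.eigenvectorUnitary : Matrix (Fin d) (Fin d) ℂ)ᴴ = 1 :=
    Matrix.mem_unitaryGroup_iff.1 hO.eigenvectorUnitary.2
  have h : (((hO.eigenvectorUnitary : Matrix (Fin d) (Fin d) ℂ)ᴴ * ρ *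
    (hO.eigenvectorUnitary : Matrix (Fin d) (Fin d) ℂ))).trace.re = 1 := by
    rw [Matrix.trace_mul_comm, ← Matrix.mul_assoc, hUU, Matrix.one_mul, hρ.2, Complex.one_re]
  rw [← h, Matrix.trace, Complex.re_sum]
  rfl

theorem sum_observableProb_mul_eigenvalues {O ρ : Matrix (Fin d) (Fin d) ℂ}
    (hO : O.IsHermitian) :
    ∑ i, observableProb hO ρ i * hO.eigenvalues i = (O * ρ).trace.re := by
  have hspec := hO.spectral_theorem
  rw [Unitary.conjStarAlgAut_apply] at hspec
  have h := trace_unitary_diagonal_mul (hO.eigenvectorUnitary : Matrix (Fin d) (Fin d) ℂ) ρ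
    hO.eigenvalues
  have h2 : (hO.eigenvectorUnitary : Matrix (Fin d) (Fin d) ℂ) *
      Matrix.diagonal (fun i => (hO.eigenvalues i : ℂ)) *
      (hO.eigenvectorUnitary : Matrix (Fin d) (Fin d) ℂ)ᴴ = O := hspec.symm
  rw [h2] at h
  rw [h]
  exact Finset.sum_congr rfl fun i _ => mul_comm _ _

end Born

/-! ### Expectations over measurement records -/

section Records

variable {d L M N₀ : ℕ} {A : Fin L → Fin (d ^ 2) → Matrix (Fin d) (Fin d) ℂ}
  {ρ₀ : Matrix (Fin d) (Fin d) ℂ} {P : Fin M → Matrix (Fin d) (Fin d) ℂ}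

theorem outputRecordProb_nonneg (hA : ∀ a, IsProcess (A a)) (hρ₀ : IsDensity ρ₀)
    (hP : IsPOVM P) (r : OutputRecord L M N₀) : 0 ≤ outputRecordProb A ρ₀ P r :=
  Finset.prod_nonneg fun a _ => seqProb_nonneg (detectProb_nonneg hP
    (posSemidef_applyKraus (A a) hρ₀.1) (trace_applyKraus_re_le_one (hA a) hρ₀)) _

theorem sum_outputRecordProb (hP : IsPOVM P) :
    ∑ r : OutputRecord L M N₀, outputRecordProb A ρ₀ P r = 1 := by
  unfold outputRecordProb
  rw [sum_prod_eq_prod_sum (fun a s => seqProb (detectProb P (applyKraus (A a) ρ₀)) s)]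
  exact Finset.prod_eq_one fun a _ => sum_seqProb (sum_detectProb hP _)

/-- Total squared error of the estimates `yHat`. -/
noncomputable def outputError (A : Fin L → Fin (d ^ 2) → Matrix (Fin d) (Fin d) ℂ)
    (ρ₀ : Matrix (Fin d) (Fin d) ℂ) (P : Fin M → Matrix (Fin d) (Fin d) ℂ)
    (r : OutputRecord L M N₀) : ℝ :=
  ∑ a, ∑ j, (yHat r a j - (P j * applyKraus (A a) ρ₀).trace.re) ^ 2

theorem outputError_nonneg (r : OutputRecord L M N₀) : 0 ≤ outputError A ρ₀ P r := by
  unfold outputError; positivity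

theorem outputExpectation_outputError_le (hN : 0 < N₀) (hA : ∀ a, IsProcess (A a))
    (hρ₀ : IsDensity ρ₀) (hP : IsPOVM P) :
    outputExpectation A ρ₀ P (outputError (N₀ := N₀) A ρ₀ P) ≤ L * M / N₀ := by
  unfold outputExpectation outputError
  simp only [Finset.mul_sum]
  rw [Finset.sum_comm]
  have h : ∀ (a : Fin L) (j : Fin M), ∑ r : OutputRecord L M N₀, outputRecordProb A ρ₀ P r *
      (yHat r a j - (P j * applyKraus (A a) ρ₀).trace.re) ^ 2 ≤ 1 / N₀ := by
    intro a j
    -- Here the independent coordinates are the experiments, each of whose values is a whole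
    -- sequence of outcomes; all experiments but `a` sum to 1.
    refine (sum_prod_mul_apply (fun a s => seqProb (detectProb P (applyKraus (A a) ρ₀)) s)
      (fun a => sum_seqProb (sum_detectProb hP _)) a
      (fun s => (freq s (some j) - (P j * applyKraus (A a) ρ₀).trace.re) ^ 2)).trans_le ?_
    exact sum_seqProb_mul_freq_sub_sq_le hN (detectProb_nonneg hP
      (posSemidef_applyKraus (A a) hρ₀.1) (trace_applyKraus_re_le_one (hA a) hρ₀))
      (sum_detectProb hP _) (some j)
  calc _ ≤ ∑ a : Fin L, ∑ j : Fin M, (1 / N₀ : ℝ) := by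
        refine Finset.sum_le_sum fun a _ => ?_
        rw [Finset.sum_comm]
        exact Finset.sum_le_sum fun j _ => h a j
    _ = L * M / N₀ := by simp; ring

theorem outputExpectation_le (hA : ∀ a, IsProcess (A a)) (hρ₀ : IsDensity ρ₀) (hP : IsPOVM P)
    {f g : OutputRecord L M N₀ → ℝ} {K : ℝ} (h : ∀ r, f r ≤ K * g r) :
    outputExpectation A ρ₀ P f ≤ K * outputExpectation A ρ₀ P g := by
  unfold outputExpectation
  rw [Finset.mul_sum]
  refine Finset.sum_le_sum fun r _ => ?_
  rw [mul_left_comm]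
  exact mul_le_mul_of_nonneg_left (h r) (outputRecordProb_nonneg hA hρ₀ hP r)

variable {O : Matrix (Fin d) (Fin d) ℂ} (hO : O.IsHermitian)

open scoped Classical in
theorem fullRecordProb_nonneg (hA : ∀ a, IsProcess (A a)) (hρ₀ : IsDensity ρ₀)
    (hP : IsPOVM P) (r : FullRecord A M N₀) : 0 ≤ fullRecordProb A ρ₀ P hO r := by
  unfold fullRecordProb
  refine mul_nonneg (mul_nonneg (mul_nonneg (outputRecordProb_nonneg hA hρ₀ hP _)
    (Finset.prod_nonneg fun a _ => seqProb_nonneg (identityProb_nonneg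
      (posSemidef_applyKraus (A a) hρ₀.1) (trace_applyKraus_re_le_one (hA a) hρ₀)) _))
    (seqProb_nonneg (mixedProb_nonneg hP) _)) (seqProb_nonneg (observableProb_nonneg hO hρ₀.1) _)

theorem fullExpectation_le (hA : ∀ a, IsProcess (A a)) (hρ₀ : IsDensity ρ₀) (hP : IsPOVM P)
    {f g : FullRecord A M N₀ → ℝ} {K : ℝ} (h : ∀ r, f r ≤ K * g r) :
    fullExpectation A ρ₀ P hO f ≤ K * fullExpectation A ρ₀ P hO g := by
  unfold fullExpectation
  rw [Finset.mul_sum]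
  refine Finset.sum_le_sum fun r _ => ?_
  rw [mul_left_comm]
  exact mul_le_mul_of_nonneg_left (h r) (fullRecordProb_nonneg hO hA hρ₀ hP r)

theorem fullExpectation_add (f g : FullRecord A M N₀ → ℝ) :
    fullExpectation A ρ₀ P hO (fun r => f r + g r) =
      fullExpectation A ρ₀ P hO f + fullExpectation A ρ₀ P hO g := by
  simp only [fullExpectation, mul_add, Finset.sum_add_distrib]

open scoped Classical in
theorem sum_identityRecordProb :
    ∑ r : {a : Fin L // ¬ IsTP (A a)} → Fin N₀ → Bool,
      ∏ a, seqProb (identityProb (applyKraus (A a.1) ρ₀)) (r a) = 1 := by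
  rw [sum_prod_eq_prod_sum (fun (a : {a : Fin L // ¬ IsTP (A a)}) s =>
    seqProb (identityProb (applyKraus (A a.1) ρ₀)) s)]
  exact Finset.prod_eq_one fun a _ => sum_seqProb (sum_identityProb _)

open scoped Classical in
/-- The expectation of a product of functions of the four independent parts of a record. -/
theorem fullExpectation_mul (f₁ : OutputRecord L M N₀ → ℝ)
    (f₂ : ({a : Fin L // ¬ IsTP (A a)} → Fin N₀ → Bool) → ℝ) (f₃ : (Fin N₀ → Fin M) → ℝ)
    (f₄ : (Fin N₀ → Fin d) → ℝ) :
    fullExpectation A ρ₀ P hO (fun r => f₁ r.1 * f₂ r.2.1 * f₃ r.2.2.1 * f₄ r.2.2.2) =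
      (∑ r, outputRecordProb A ρ₀ P r * f₁ r) *
      (∑ r : {a : Fin L // ¬ IsTP (A a)} → Fin N₀ → Bool,
        (∏ a, seqProb (identityProb (applyKraus (A a.1) ρ₀)) (r a)) * f₂ r) *
      (∑ s, seqProb (mixedProb P) s * f₃ s) *
      (∑ s, seqProb (observableProb hO ρ₀) s * f₄ s) := by
  have h : ∀ r : FullRecord A M N₀, fullRecordProb A ρ₀ P hO r *
      (f₁ r.1 * f₂ r.2.1 * f₃ r.2.2.1 * f₄ r.2.2.2) =
      (outputRecordProb A ρ₀ P r.1 * f₁ r.1) *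
      (((∏ a, seqProb (identityProb (applyKraus (A a.1) ρ₀)) (r.2.1 a)) * f₂ r.2.1) *
      ((seqProb (mixedProb P) r.2.2.1 * f₃ r.2.2.1) *
      (seqProb (observableProb hO ρ₀) r.2.2.2 * f₄ r.2.2.2))) := by
    intro r
    unfold fullRecordProb
    ring
  unfold fullExpectation
  rw [Finset.sum_congr rfl fun r _ => h r]
  simp only [Fintype.sum_prod_type, ← Finset.mul_sum, ← Finset.sum_mul]
  ring

open scoped Classical in
/-- Total squared error of the data of the orthonormal-basis algorithm. -/
noncomputable def fullError (A : Fin L → Fin (d ^ 2) → Matrix (Fin d) (Fin d) ℂ)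
    (ρ₀ : Matrix (Fin d) (Fin d) ℂ) (P : Fin M → Matrix (Fin d) (Fin d) ℂ)
    {O : Matrix (Fin d) (Fin d) ℂ} (hO : O.IsHermitian) (r : FullRecord A M N₀) : ℝ :=
  outputError A ρ₀ P r.1 +
    ∑ a : {a : Fin L // ¬ IsTP (A a)},
      (freq (r.2.1 a) true - (applyKraus (A a.1) ρ₀).trace.re) ^ 2 +
    ∑ j, (freq r.2.2.1 j - mixedProb P j) ^ 2 + (observableMean hO r - (O * ρ₀).trace.re) ^ 2

theorem fullError_nonneg (r : FullRecord A M N₀) : 0 ≤ fullError A ρ₀ P hO r := by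
  have := outputError_nonneg (A := A) (ρ₀ := ρ₀) (P := P) r.1
  unfold fullError; positivity

open scoped Classical in
theorem exists_fullExpectation_fullError_le (hd : d ≠ 0) (hA : ∀ a, IsProcess (A a))
    (hρ₀ : IsDensity ρ₀) (hP : IsPOVM P) :
    ∃ C : ℝ, 0 ≤ C ∧ ∀ N₀ : ℕ, 0 < N₀ →
      fullExpectation A ρ₀ P hO (fullError (N₀ := N₀) A ρ₀ P hO) ≤ C / N₀ := by
  set v := ∑ i, observableProb hO ρ₀ i * (hO.eigenvalues i - (O * ρ₀).trace.re) ^ 2 with hv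
  have hv0 : 0 ≤ v := Finset.sum_nonneg fun i _ =>
    mul_nonneg (observableProb_nonneg hO hρ₀.1 i) (sq_nonneg _)
  -- One unit for each estimated frequency: `L * M` on the outputs, one per process that is not
  -- trace preserving, `M` on the maximally mixed state. The last term `v` is the variance of the
  -- observable.
  refine ⟨L * M + Fintype.card {a : Fin L // ¬ IsTP (A a)} + M + v, by positivity,
    fun N₀ hN => ?_⟩
  have s1 := sum_outputRecordProb (A := A) (ρ₀ := ρ₀) (N₀ := N₀) hP
  have s2 := sum_identityRecordProb (A := A) (ρ₀ := ρ₀) (N₀ := N₀)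
  have s3 : ∑ s : Fin N₀ → Fin M, seqProb (mixedProb P) s = 1 := sum_seqProb (sum_mixedProb hd hP)
  have s4 : ∑ s : Fin N₀ → Fin d, seqProb (observableProb hO ρ₀) s = 1 :=
    sum_seqProb (sum_observableProb hO hρ₀)
  have e1 : fullExpectation A ρ₀ P hO (fun r : FullRecord A M N₀ => outputError A ρ₀ P r.1) ≤
      L * M / N₀ := by
    have := fullExpectation_mul (A := A) (ρ₀ := ρ₀) (P := P) hO (N₀ := N₀)
      (outputError A ρ₀ P) (fun _ => 1) (fun _ => 1) (fun _ => 1)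
    simp only [mul_one, s2, s3, s4] at this
    rw [this]
    exact outputExpectation_outputError_le hN hA hρ₀ hP
  have e2 : fullExpectation A ρ₀ P hO (fun r : FullRecord A M N₀ =>
      ∑ a : {a : Fin L // ¬ IsTP (A a)},
        (freq (r.2.1 a) true - (applyKraus (A a.1) ρ₀).trace.re) ^ 2) ≤
      Fintype.card {a : Fin L // ¬ IsTP (A a)} / N₀ := by
    have := fullExpectation_mul (A := A) (ρ₀ := ρ₀) (P := P) hO (N₀ := N₀)
      (fun _ => 1) (fun r => ∑ a : {a : Fin L // ¬ IsTP (A a)},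
        (freq (r a) true - (applyKraus (A a.1) ρ₀).trace.re) ^ 2) (fun _ => 1) (fun _ => 1)
    simp only [mul_one, one_mul, s1, s3, s4] at this
    rw [this]
    simp only [Finset.mul_sum]
    rw [Finset.sum_comm]
    calc _ ≤ ∑ a : {a : Fin L // ¬ IsTP (A a)}, (1 / N₀ : ℝ) := by
          refine Finset.sum_le_sum fun a _ => ?_
          refine (sum_prod_mul_apply (fun (a : {a : Fin L // ¬ IsTP (A a)}) s =>
            seqProb (identityProb (applyKraus (A a.1) ρ₀)) s)
            (fun a => sum_seqProb (sum_identityProb _)) a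
            (fun s => (freq s true - (applyKraus (A a.1) ρ₀).trace.re) ^ 2)).trans_le ?_
          exact sum_seqProb_mul_freq_sub_sq_le hN (identityProb_nonneg
            (posSemidef_applyKraus (A a) hρ₀.1) (trace_applyKraus_re_le_one (hA a) hρ₀))
            (sum_identityProb _) true
      _ = _ := by simp [div_eq_mul_inv]
  have e3 : fullExpectation A ρ₀ P hO (fun r : FullRecord A M N₀ =>
      ∑ j, (freq r.2.2.1 j - mixedProb P j) ^ 2) ≤ M / N₀ := by
    have := fullExpectation_mul (A := A) (ρ₀ := ρ₀) (P := P) hO (N₀ := N₀)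
      (fun _ => 1) (fun _ => 1) (fun s => ∑ j, (freq s j - mixedProb P j) ^ 2) (fun _ => 1)
    simp only [mul_one, one_mul, s1, s2, s4] at this
    rw [this]
    simp only [Finset.mul_sum]
    rw [Finset.sum_comm]
    calc _ ≤ ∑ j : Fin M, (1 / N₀ : ℝ) := Finset.sum_le_sum fun j _ =>
          sum_seqProb_mul_freq_sub_sq_le hN (mixedProb_nonneg hP) (sum_mixedProb hd hP) j
      _ = _ := by simp [div_eq_mul_inv]
  have e4 : fullExpectation A ρ₀ P hO (fun r : FullRecord A M N₀ =>
      (observableMean hO r - (O * ρ₀).trace.re) ^ 2) = v / N₀ := by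
    have := fullExpectation_mul (A := A) (ρ₀ := ρ₀) (P := P) hO (N₀ := N₀)
      (fun _ => 1) (fun _ => 1) (fun _ => 1)
      (fun s => ((∑ i, hO.eigenvalues (s i)) / N₀ - (O * ρ₀).trace.re) ^ 2)
    simp only [one_mul, mul_one, s1, s2, s3] at this
    rw [sum_seqProb_mul_average_sub_sq hN (sum_observableProb hO hρ₀) hO.eigenvalues
      (sum_observableProb_mul_eigenvalues hO)] at this
    exact this
  unfold fullError
  rw [fullExpectation_add, fullExpectation_add, fullExpectation_add, e4, add_div, add_div, add_div]
  linarith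

end Records

/-! ### Error bounds for single records -/

section Deterministic

open Filter Asymptotics Topology

variable {d L M : ℕ} {A : Fin L → Fin (d ^ 2) → Matrix (Fin d) (Fin d) ℂ}
  {ρ₀ : Matrix (Fin d) (Fin d) ℂ} {P : Fin M → Matrix (Fin d) (Fin d) ℂ}

theorem IsDensity.dim_ne_zero (h : IsDensity ρ₀) : d ≠ 0 := by
  rintro rfl
  simpa [Matrix.trace] using h.2

theorem IsPOVM.card_ne_zero (hd : d ≠ 0) (h : IsPOVM P) : M ≠ 0 := by
  rintro rfl
  have h1 := congrFun (congrFun h.2 ⟨0, Nat.pos_of_ne_zero hd⟩) ⟨0, Nat.pos_of_ne_zero hd⟩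
  simp at h1

theorem sq_yHat_sub_le_outputError {N₀ : ℕ} (r : OutputRecord L M N₀) (a : Fin L) (j : Fin M) :
    (yHat r a j - (P j * applyKraus (A a) ρ₀).trace.re) ^ 2 ≤ outputError A ρ₀ P r :=
  (Finset.single_le_sum (f := fun j => (yHat r a j - (P j * applyKraus (A a) ρ₀).trace.re) ^ 2)
    (fun _ _ => sq_nonneg _) (Finset.mem_univ j)).trans
  (Finset.single_le_sum
    (f := fun a => ∑ j, (yHat r a j - (P j * applyKraus (A a) ρ₀).trace.re) ^ 2)
    (fun _ _ => by positivity) (Finset.mem_univ a))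

theorem sq_freq_sub_le_fullError {N₀ : ℕ} {O : Matrix (Fin d) (Fin d) ℂ} (hO : O.IsHermitian)
    (r : FullRecord A M N₀) :
    (∀ a j, (yHat r.1 a j - (P j * applyKraus (A a) ρ₀).trace.re) ^ 2 ≤
      fullError A ρ₀ P hO r) ∧
    (∀ a : {a : Fin L // ¬ IsTP (A a)},
      (freq (r.2.1 a) true - (applyKraus (A a.1) ρ₀).trace.re) ^ 2 ≤ fullError A ρ₀ P hO r) ∧
    (∀ j, (freq r.2.2.1 j - mixedProb P j) ^ 2 ≤ fullError A ρ₀ P hO r) ∧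
    (observableMean hO r - (O * ρ₀).trace.re) ^ 2 ≤ fullError A ρ₀ P hO r := by
  classical
  have h1 := outputError_nonneg (A := A) (ρ₀ := ρ₀) (P := P) r.1
  have h2 : 0 ≤ ∑ a : {a : Fin L // ¬ IsTP (A a)},
      (freq (r.2.1 a) true - (applyKraus (A a.1) ρ₀).trace.re) ^ 2 := by positivity
  have h3 : 0 ≤ ∑ j, (freq r.2.2.1 j - mixedProb P j) ^ 2 := by positivity
  have h4 : 0 ≤ (observableMean hO r - (O * ρ₀).trace.re) ^ 2 := sq_nonneg _
  have hdef : fullError A ρ₀ P hO r = outputError A ρ₀ P r.1 +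
    ∑ a : {a : Fin L // ¬ IsTP (A a)},
      (freq (r.2.1 a) true - (applyKraus (A a.1) ρ₀).trace.re) ^ 2 +
    ∑ j, (freq r.2.2.1 j - mixedProb P j) ^ 2 + (observableMean hO r - (O * ρ₀).trace.re) ^ 2 := by
    unfold fullError
    congr!
  rw [hdef]
  refine ⟨fun a j => ?_, fun a => ?_, fun j => ?_, by linarith⟩
  · linarith [sq_yHat_sub_le_outputError (A := A) (ρ₀ := ρ₀) (P := P) r.1 a j]
  · linarith [Finset.single_le_sum (f := fun a : {a : Fin L // ¬ IsTP (A a)} =>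
      (freq (r.2.1 a) true - (applyKraus (A a.1) ρ₀).trace.re) ^ 2)
      (fun _ _ => sq_nonneg _) (Finset.mem_univ a)]
  · linarith [Finset.single_le_sum (f := fun j => (freq r.2.2.1 j - mixedProb P j) ^ 2)
      (fun _ _ => sq_nonneg _) (Finset.mem_univ j)]

variable {ι : Type*} {l : Filter ι} {e : ι → ℝ}

theorem isBigO_of_sq_le {f err : ι → ℝ} (h : ∀ i, f i ^ 2 ≤ err i) :
    f =O[l] fun i => Real.sqrt (err i) :=
  isBigO_of_abs_le fun i => Real.abs_le_sqrt (h i)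

theorem StateChoice.combine_apply {κ E : Type*} [AddCommGroup E] [Module ℝ E]
    (ch : StateChoice M) (v : Fin M → κ → E) (k : κ) :
    ch.combine v k = ch.combine fun j => v j k := by
  cases ch <;> simp [StateChoice.combine]

/-- The errors of the coefficients computed by the orthonormal-basis algorithm. -/
theorem isBigO_rescaled_factors {n : Type*} (he : Tendsto e l (𝓝 0)) {x₀ c₀ : n → ℝ} {k₀ : n}
    (hk₀ : x₀ k₀ ≠ 0) {μ : ι → ℝ} (hμ : (fun i => μ i - x₀ k₀) =O[l] e) {x c : ι → n → ℝ}
    (hxc : ∀ k k', (fun i => x i k * c i k' - x₀ k * c₀ k') =O[l] e) :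
    (∀ k, (fun i => x i k₀ / μ i * c i k - c₀ k) =O[l] e) ∧
    ((∃ k', c₀ k' ≠ 0) → ∀ k, (fun i => μ i / x i k₀ * x i k - x₀ k) =O[l] e) := by
  constructor
  · intro k
    -- The detector coefficient uses only the product `x i k₀ * c i k`, so the free scalar has
    -- cancelled and `c₀` may vanish.
    refine (isBigO_div_sub he (hxc k₀ k) hμ hk₀).congr_left fun i => ?_
    rw [mul_div_cancel_left₀ _ hk₀, div_mul_eq_mul_div]
  · rintro ⟨k', hk'⟩ k
    -- The ratio `x i k / x i k₀` is expanded by `c i k'`. Numerator and denominator are then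
    -- controlled products, and the denominator has a nonzero limit.
    have hne : x₀ k₀ * c₀ k' ≠ 0 := mul_ne_zero hk₀ hk'
    have h := isBigO_mul_sub he hμ (isBigO_div_sub he (hxc k k') (hxc k₀ k') hne)
    have ht : Tendsto (fun i => x i k₀ * c i k') l (𝓝 (x₀ k₀ * c₀ k')) :=
      tendsto_sub_nhds_zero_iff.1 ((hxc k₀ k').trans_tendsto he)
    refine h.congr' ?_ EventuallyEq.rfl
    filter_upwards [ht.eventually_ne hne] with i hi
    obtain ⟨h1, h2⟩ := mul_ne_zero_iff.1 hi
    field_simp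

theorem isBigO_YHat (he : Tendsto e l (𝓝 0)) (hρ₀ : IsDensity ρ₀)
    {N : ι → ℕ} {r : ∀ i, FullRecord A M (N i)} (j : Fin M) (a : Fin L)
    (hy : (fun i => yHat (r i).1 a j - (P j * applyKraus (A a) ρ₀).trace.re) =O[l] e)
    (hx : ∀ h : ¬ IsTP (A a),
      (fun i => freq ((r i).2.1 ⟨a, h⟩) true - (applyKraus (A a) ρ₀).trace.re) =O[l] e)
    (hc : (fun i => cHatZero (r i) j - (P j).trace.re / Real.sqrt d) =O[l] e) :
    (fun i => YHat (r i) j a - ((P j * applyKraus (A a) ρ₀).trace.re -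
        (applyKraus (A a) ρ₀).trace.re / Real.sqrt d * ((P j).trace.re / Real.sqrt d)))
      =O[l] e := by
  have hx0 : (fun i => xHatZero (r i) a - (applyKraus (A a) ρ₀).trace.re / Real.sqrt d)
      =O[l] e := by
    by_cases h : IsTP (A a)
    · simp only [xHatZero, h, dif_pos, trace_applyKraus_of_isTP h, hρ₀.2, Complex.one_re, sub_self]
      exact isBigO_zero _ _
    · refine ((hx h).const_mul_left (1 / Real.sqrt d)).congr_left fun i => ?_
      simp only [xHatZero, h, dif_neg, not_false_eq_true]
      ring
  refine (hy.sub (isBigO_mul_sub he hx0 hc)).congr_left fun i => ?_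
  simp only [YHat]
  ring

/-- The deterministic half of part (a): the squared output error is bounded by the squared data
error for every record, likely or not, so that only an expectation of squared data errors remains.
-/
theorem exists_orthonormal_bound (hρ₀ : IsDensity ρ₀) (hP : IsPOVM P)
    {Ω : Fin (d ^ 2 - 1) → Matrix (Fin d) (Fin d) ℂ} (hΩ : IsTracelessBasis Ω)
    (k₀ : Fin (d ^ 2 - 1)) (hA : ∀ a, IsGeneralizedUnital (A a))
    (hrank : (designB Ω A).rank = (d ^ 2 - 1) ^ 2) (hk₀ : coeff Ω ρ₀ k₀ ≠ 0)
    (ch : StateChoice M) :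
    ∃ K : ℝ, ∀ (N₀ : ℕ) (r : FullRecord A M N₀) (ρh : Matrix (Fin d) (Fin d) ℂ)
      (Ph : Fin M → Matrix (Fin d) (Fin d) ℂ), IsOrthonormalOutput hΩ k₀ A ch r ρh Ph →
      ((∀ j, ch.Uses j → ∃ k, coeff Ω (P j) k ≠ 0) →
        frobSq (ρh - ρ₀) ≤ K * fullError A ρ₀ P (hΩ.herm k₀) r) ∧
      ∑ j, frobSq (Ph j - P j) ≤ K * fullError A ρ₀ P (hΩ.herm k₀) r := by
  have hd := hρ₀.dim_ne_zero
  have hM := hP.card_ne_zero hd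
  have hd0 : (0 : ℝ) < d := by positivity
  -- The index set contains all sample sizes, all records and all admissible outputs at once. Bounds
  -- along the filter of small `e` on it are therefore uniform in `N₀` and in the choice of singular
  -- value decompositions.
  set ι := {c : Σ N₀ : ℕ, FullRecord A M N₀ × Matrix (Fin d) (Fin d) ℂ ×
    (Fin M → Matrix (Fin d) (Fin d) ℂ) //
      IsOrthonormalOutput hΩ k₀ A ch c.2.1 c.2.2.1 c.2.2.2} with hι
  set r : ∀ i : ι, FullRecord A M i.1.1 := fun i => i.1.2.1 with hr
  set err : ι → ℝ := fun i => fullError A ρ₀ P (hΩ.herm k₀) (r i) with herr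
  set e : ι → ℝ := fun i => Real.sqrt (err i) with he_def
  have herr0 : ∀ i, 0 ≤ err i := fun i => fullError_nonneg _ _
  have hsq : ∀ i, e i ^ 2 = err i := fun i => Real.sq_sqrt (herr0 i)
  have he : Tendsto e (comap e (𝓝 0)) (𝓝 0) := tendsto_comap
  have hdata := fun i : ι => sq_freq_sub_le_fullError (ρ₀ := ρ₀) (P := P) (hΩ.herm k₀) (r i)
  choose xt ct hsvd xb cb hxb hcb hstate hdet using fun i : ι => i.2
  have hc0 : ∀ j, (fun i => cHatZero (r i) j - (P j).trace.re / Real.sqrt d)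
      =O[comap e (𝓝 0)] e := by
    intro j
    have h1 : (fun i => freq (r i).2.2.1 j - mixedProb P j) =O[comap e (𝓝 0)] e :=
      isBigO_of_sq_le fun i => (hdata i).2.2.1 j
    refine (h1.const_mul_left (Real.sqrt d)).congr_left fun i => ?_
    rw [mixedProb_eq, mul_sub, cHatZero]
    congr 1
    rw [mul_div_left_comm, Real.sqrt_div_self', mul_one_div]
  have hμ : (fun i => observableMean (hΩ.herm k₀) (r i) - coeff Ω ρ₀ k₀)
      =O[comap e (𝓝 0)] e := isBigO_of_sq_le fun i => (hdata i).2.2.2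
  have hxc : ∀ j k k', (fun i => xt i j k * ct i j k' - coeff Ω ρ₀ k * coeff Ω (P j) k')
      =O[comap e (𝓝 0)] e := by
    intro j
    refine isBigO_svdFactor (by rw [hrank, Fintype.card_prod, Fintype.card_fin, sq])
      (fun i => hsvd i j) _ _ fun a => ?_
    rw [designB_mulVec hd hΩ hA hρ₀.1.1 (hP.1 j).1]
    exact isBigO_YHat he hρ₀ j a (isBigO_of_sq_le fun i => (hdata i).1 a j)
      (fun h => isBigO_of_sq_le fun i => (hdata i).2.1 ⟨a, h⟩) (hc0 j)
  have hfac := fun j => isBigO_rescaled_factors he hk₀ hμ (hxc j)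
  have hdetO : ∀ j, (fun i : ι => ‖i.1.2.2.2 j - P j‖) =O[comap e (𝓝 0)] e := by
    refine isBigO_detectorCorrection he hP hdet fun j => ?_
    have h2 := fun k => isBigO_smul_const ((hfac j).1 k) (Ω k)
    refine ((isBigO_smul_const (hc0 j) (fullBasis Ω none)).add
      (IsBigO.fun_sum fun k (_ : k ∈ Finset.univ) => h2 k)).congr_left fun i => ?_
    conv_rhs => rw [hΩ.expansion hd (hP.1 j).1]
    simp only [hcb, Pi.smul_apply, smul_eq_mul, Complex.ofReal_sub, sub_smul,
      Finset.sum_sub_distrib]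
    abel
  have hPbound : ∀ j, ∃ K, ∀ i : ι, ‖i.1.2.2.2 j - P j‖ ^ 2 ≤ K * e i ^ 2 := by
    intro j
    -- Both detectors are physical, and each of their elements has norm at most `d`.
    refine exists_sq_bound (C := d + d) (fun i => Real.sqrt_nonneg _) (fun i => ?_) (hdetO j)
    rw [abs_norm]
    exact (norm_sub_le _ _).trans (add_le_add ((hdet i).1.norm_le j) (hP.norm_le j))
  choose KP hKP using hPbound
  have hρbound : ∃ K, (∀ j, ch.Uses j → ∃ k, coeff Ω (P j) k ≠ 0) →
      ∀ i : ι, ‖i.1.2.2.1 - ρ₀‖ ^ 2 ≤ K * e i ^ 2 := by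
    by_cases huse : ∀ j, ch.Uses j → ∃ k, coeff Ω (P j) k ≠ 0
    · have hxbO : ∀ k, (fun i => xb i k - coeff Ω ρ₀ k) =O[comap e (𝓝 0)] e := by
        intro k
        simp only [hxb, StateChoice.combine_apply]
        exact ch.isBigO_combine_sub hM fun j hj => (hfac j).2 (huse j hj) k
      have hO : (fun i : ι => ‖i.1.2.2.1 - ρ₀‖) =O[comap e (𝓝 0)] e := by
        refine isBigO_stateCorrection hρ₀ hstate (Eventually.of_forall fun i => ?_) ?_
        · simp only [fullBasis, Matrix.trace_add, Matrix.trace_smul, Matrix.trace_sum,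
            hΩ.trace_zero, smul_eq_mul, mul_zero, Finset.sum_const_zero, add_zero,
            Matrix.trace_one, Fintype.card_fin]
          -- The uncorrected state has trace one on every record, whatever its estimated
          -- coefficients, since the `Ω k` are traceless.
          have : (1 / Real.sqrt d) * ((1 / Real.sqrt d) * d) = 1 := by
            rw [← mul_assoc, div_mul_div_comm, Real.mul_self_sqrt hd0.le, one_mul,
              one_div_mul_cancel hd0.ne']
          exact_mod_cast this
        · refine (IsBigO.fun_sum fun k (_ : k ∈ Finset.univ) =>
            isBigO_smul_const (hxbO k) (Ω k)).congr_left fun i => ?_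
          conv_rhs => rw [hΩ.expansion hd hρ₀.1.1, hρ₀.2, Complex.one_re]
          simp only [Complex.ofReal_sub, sub_smul, Finset.sum_sub_distrib]
          abel
      obtain ⟨K, hK⟩ := exists_sq_bound (C := 1 + 1) (fun i => Real.sqrt_nonneg _)
        (fun i => by
          rw [abs_norm]
          exact (norm_sub_le _ _).trans (add_le_add (hstate i).1.norm_le_one hρ₀.norm_le_one)) hO
      exact ⟨K, fun _ => hK⟩
    · exact ⟨0, fun h => absurd h huse⟩
  obtain ⟨Kρ, hKρ⟩ := hρbound
  refine ⟨max Kρ (∑ j, KP j), fun N₀ r ρh Ph h => ?_⟩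
  set i : ι := ⟨⟨N₀, r, ρh, Ph⟩, h⟩ with hi
  have hle : ∀ {K}, K ≤ max Kρ (∑ j, KP j) →
      K * e i ^ 2 ≤ max Kρ (∑ j, KP j) * fullError A ρ₀ P (hΩ.herm k₀) r := fun hK => by
    rw [hsq]
    exact mul_le_mul_of_nonneg_right hK (herr0 i)
  refine ⟨fun huse => ?_, ?_⟩
  · rw [frobSq_eq_norm_sq]
    exact (hKρ huse i).trans (hle (le_max_left _ _))
  · refine le_trans ?_ (hle (le_max_right _ _))
    rw [Finset.sum_mul]
    refine Finset.sum_le_sum fun j _ => ?_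
    rw [frobSq_eq_norm_sq]
    exact hKP j i

/-! ### The natural-basis algorithm on single records -/

theorem StateChoice.combine_matrix_apply (ch : StateChoice M)
    (v : Fin M → Matrix (Fin d) (Fin d) ℂ) (k k' : Fin d) :
    ch.combine v k k' = ch.combine fun j => v j k k' := by
  cases ch <;> simp [StateChoice.combine, Matrix.sum_apply]

theorem StateChoice.trace_combine (hM : M ≠ 0) (ch : StateChoice M)
    (v : Fin M → Matrix (Fin d) (Fin d) ℂ) (h : ∀ j, ch.Uses j → (v j).trace = 1) :
    (ch.combine v).trace = 1 := by
  cases ch with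
  | single j => exact h j rfl
  | average =>
    have hM' : (M : ℂ) ≠ 0 := Nat.cast_ne_zero.2 hM
    simp [StateChoice.combine, Matrix.trace_smul, Matrix.trace_sum,
      fun j => h j trivial, hM']

theorem isBigO_hermitianPart {X : ι → Matrix (Fin d) (Fin d) ℂ} {X₀ : Matrix (Fin d) (Fin d) ℂ}
    (hX₀ : X₀.IsHermitian) (h : ∀ k k', (fun i => X i k k' - X₀ k k') =O[l] e) :
    (fun i => (1 / 2 : ℂ) • (X i + (X i)ᴴ) - X₀) =O[l] e := by
  refine isBigO_matrix fun k k' => ?_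
  have h2 : (fun i => star (X i k' k - X₀ k' k)) =O[l] e :=
    (IsBigO.of_bound 1 (Eventually.of_forall fun i => by rw [norm_star, one_mul])).trans (h k' k)
  refine (((h k k').add h2).const_mul_left (1 / 2)).congr_left fun i => ?_
  have h3 : star (X₀ k' k) = X₀ k k' := hX₀.apply k k'
  simp only [star_sub, h3, Matrix.sub_apply, Matrix.smul_apply, Matrix.add_apply,
    Matrix.conjTranspose_apply, smul_eq_mul]
  ring

/-- As in the orthonormal basis, but the free scalar is fixed by the trace, which is known to be 1
for the true state, so no further measurement enters. -/
theorem exists_natural_bound (hρ₀ : IsDensity ρ₀) (hP : IsPOVM P)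
    (hrank : (designNatural A).rank = d ^ 4) (ch : StateChoice M) :
    ∃ K : ℝ, ∀ (N₀ : ℕ) (r : OutputRecord L M N₀) (ρh : Matrix (Fin d) (Fin d) ℂ)
      (Ph : Fin M → Matrix (Fin d) (Fin d) ℂ), IsNaturalOutput A ch r ρh Ph →
      ((∀ j, ch.Uses j → P j ≠ 0) → frobSq (ρh - ρ₀) ≤ K * outputError A ρ₀ P r) ∧
      ∑ j, frobSq (Ph j - P j) ≤ K * outputError A ρ₀ P r := by
  have hd := hρ₀.dim_ne_zero
  have hM := hP.card_ne_zero hd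
  set ι := {c : Σ N₀ : ℕ, OutputRecord L M N₀ × Matrix (Fin d) (Fin d) ℂ ×
    (Fin M → Matrix (Fin d) (Fin d) ℂ) // IsNaturalOutput A ch c.2.1 c.2.2.1 c.2.2.2} with hι
  set r : ∀ i : ι, OutputRecord L M i.1.1 := fun i => i.1.2.1 with hr
  set err : ι → ℝ := fun i => outputError A ρ₀ P (r i) with herr
  set e : ι → ℝ := fun i => Real.sqrt (err i) with he_def
  have herr0 : ∀ i, 0 ≤ err i := fun i => outputError_nonneg _
  have hsq : ∀ i, e i ^ 2 = err i := fun i => Real.sq_sqrt (herr0 i)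
  have he : Tendsto e (comap e (𝓝 0)) (𝓝 0) := tendsto_comap
  choose ρs Ps hsvd ρt ρ' Pt hρt hPt hρ' hstate hdet using fun i : ι => i.2
  have hxc : ∀ j p p', (fun i => Matrix.vec (ρs i j) p * Matrix.vec (Ps i j)ᵀ p' -
      Matrix.vec ρ₀ p * Matrix.vec (P j)ᵀ p') =O[comap e (𝓝 0)] e := by
    intro j
    refine isBigO_svdFactor (by
      rw [hrank]; simp only [Fintype.card_prod, Fintype.card_fin]; ring)
      (fun i => hsvd i j) _ _ fun a => ?_
    have h1 : (fun i => yHat (r i) a j - (P j * applyKraus (A a) ρ₀).trace.re)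
        =O[comap e (𝓝 0)] e := isBigO_of_sq_le fun i => sq_yHat_sub_le_outputError _ a j
    rw [designNatural_mulVec,
      trace_mul_eq_ofReal (hP.1 j).1 (posSemidef_applyKraus (A a) hρ₀.1).1]
    refine (Complex.isBigO_ofReal_left.2 h1).congr_left fun i => ?_
    rw [Complex.ofReal_sub]
  -- Column stacking reverses the indices of the state; for the detector the reversal is undone by
  -- the transpose.
  have hprod : ∀ j k k' m m', (fun i => ρs i j k k' * Ps i j m m' - ρ₀ k k' * P j m m')
      =O[comap e (𝓝 0)] e := fun j k k' m m' => hxc j (k', k) (m, m')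
  -- Summing the products over the diagonal of the state factor replaces that factor by its trace,
  -- and the exact trace is 1. This is the error of the rescaled detector, found without any
  -- division.
  have htr : ∀ j m m', (fun i => (ρs i j).trace * Ps i j m m' - P j m m')
      =O[comap e (𝓝 0)] e := by
    intro j m m'
    have h1 : (fun i => ∑ k, (ρs i j k k * Ps i j m m' - ρ₀ k k * P j m m'))
        =O[comap e (𝓝 0)] e := IsBigO.fun_sum fun k _ => hprod j k k m m'
    refine h1.congr_left fun i => ?_
    rw [Finset.sum_sub_distrib, ← Finset.sum_mul, ← Finset.sum_mul]
    change (ρs i j).trace * _ - ρ₀.trace * _ = _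
    rw [hρ₀.2, one_mul]
  have hdetO : ∀ j, (fun i : ι => ‖i.1.2.2.2 j - P j‖) =O[comap e (𝓝 0)] e := by
    refine isBigO_detectorCorrection he hP hdet fun j => ?_
    refine isBigO_hermitianPart (hP.1 j).1 fun m m' => ?_
    simpa only [hPt, Matrix.smul_apply, smul_eq_mul] using htr j m m'
  have hPbound : ∀ j, ∃ K, ∀ i : ι, ‖i.1.2.2.2 j - P j‖ ^ 2 ≤ K * e i ^ 2 := by
    intro j
    refine exists_sq_bound (C := d + d) (fun i => Real.sqrt_nonneg _) (fun i => ?_) (hdetO j)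
    rw [abs_norm]
    exact (norm_sub_le _ _).trans (add_le_add ((hdet i).1.norm_le j) (hP.norm_le j))
  choose KP hKP using hPbound
  have hρbound : ∃ K, (∀ j, ch.Uses j → P j ≠ 0) →
      ∀ i : ι, ‖i.1.2.2.1 - ρ₀‖ ^ 2 ≤ K * e i ^ 2 := by
    by_cases huse : ∀ j, ch.Uses j → P j ≠ 0
    · have hnz : ∀ j, ch.Uses j → ∀ᶠ i in comap e (𝓝 0), (ρs i j).trace ≠ 0 := by
        intro j hj
        obtain ⟨m, m', hm⟩ : ∃ m m', P j m m' ≠ 0 := by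
          by_contra! hc
          exact huse j hj (Matrix.ext hc)
        have ht : Tendsto (fun i => (ρs i j).trace * Ps i j m m') (comap e (𝓝 0))
            (𝓝 (P j m m')) := tendsto_sub_nhds_zero_iff.1 ((htr j m m').trans_tendsto he)
        filter_upwards [ht.eventually_ne hm] with i hi
        exact left_ne_zero_of_mul hi
      have hnorm : ∀ j, ch.Uses j → ∀ k k',
          (fun i => ((ρs i j).trace⁻¹ • ρs i j) k k' - ρ₀ k k') =O[comap e (𝓝 0)] e := by
        intro j hj k k'
        obtain ⟨m, m', hm⟩ : ∃ m m', P j m m' ≠ 0 := by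
          by_contra! hc
          exact huse j hj (Matrix.ext hc)
        have ht : Tendsto (fun i => (ρs i j).trace * Ps i j m m') (comap e (𝓝 0))
            (𝓝 (P j m m')) := tendsto_sub_nhds_zero_iff.1 ((htr j m m').trans_tendsto he)
        -- Both parts of the normalized state are multiplied by `Ps i j m m'` at an entry where the
        -- exact detector does not vanish; this makes the quotient one of controlled products.
        refine (isBigO_div_sub he (hprod j k k' m m') (htr j m m') hm).congr' ?_ EventuallyEq.rfl
        filter_upwards [ht.eventually_ne hm] with i hi
        obtain ⟨h1, h2⟩ := mul_ne_zero_iff.1 hi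
        rw [mul_div_cancel_right₀ _ hm, mul_div_mul_right _ _ h2, Matrix.smul_apply, smul_eq_mul,
          div_eq_inv_mul]
      have hρtO : ∀ k k', (fun i => ρt i k k' - ρ₀ k k') =O[comap e (𝓝 0)] e := by
        intro k k'
        simp only [hρt, StateChoice.combine_matrix_apply]
        exact ch.isBigO_combine_sub hM fun j hj => hnorm j hj k k'
      -- Normalization fails where a trace vanishes, and the quotient is then 0. This is excluded
      -- only for small errors, so trace one holds eventually and not on every record.
      have htr1 : ∀ᶠ i in comap e (𝓝 0), (ρ' i).trace = 1 := by
        have hall : ∀ᶠ i in comap e (𝓝 0), ∀ j, ch.Uses j → (ρs i j).trace ≠ 0 := by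
          rw [eventually_all]
          intro j
          by_cases hj : ch.Uses j
          · filter_upwards [hnz j hj] with i hi _ using hi
          · exact Eventually.of_forall fun i h => absurd h hj
        filter_upwards [hall] with i hi
        have h1 : (ρt i).trace = 1 := by
          rw [hρt]
          refine ch.trace_combine hM _ fun j hj => ?_
          rw [Matrix.trace_smul, smul_eq_mul, inv_mul_cancel₀ (hi j hj)]
        rw [hρ', Matrix.trace_smul, Matrix.trace_add, Matrix.trace_conjTranspose, h1]
        norm_num
      have hρ'O : (fun i => ρ' i - ρ₀) =O[comap e (𝓝 0)] e := by
        simp only [hρ']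
        exact isBigO_hermitianPart hρ₀.1.1 hρtO
      have hO : (fun i : ι => ‖i.1.2.2.1 - ρ₀‖) =O[comap e (𝓝 0)] e := by
        refine isBigO_stateCorrection hρ₀ hstate ?_ (hρ'O.congr' ?_ EventuallyEq.rfl)
        · filter_upwards [htr1] with i hi
          rw [hi, inv_one, one_smul, hi]
        · filter_upwards [htr1] with i hi
          rw [hi, inv_one, one_smul]
      obtain ⟨K, hK⟩ := exists_sq_bound (C := 1 + 1) (fun i => Real.sqrt_nonneg _)
        (fun i => by
          rw [abs_norm]
          exact (norm_sub_le _ _).trans (add_le_add (hstate i).1.norm_le_one hρ₀.norm_le_one)) hO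
      exact ⟨K, fun _ => hK⟩
    · exact ⟨0, fun h => absurd h huse⟩
  obtain ⟨Kρ, hKρ⟩ := hρbound
  refine ⟨max Kρ (∑ j, KP j), fun N₀ r ρh Ph h => ?_⟩
  set i : ι := ⟨⟨N₀, r, ρh, Ph⟩, h⟩ with hi
  have hle : ∀ {K}, K ≤ max Kρ (∑ j, KP j) →
      K * e i ^ 2 ≤ max Kρ (∑ j, KP j) * outputError A ρ₀ P r := fun hK => by
    rw [hsq]
    exact mul_le_mul_of_nonneg_right hK (herr0 i)
  refine ⟨fun huse => ?_, ?_⟩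
  · rw [frobSq_eq_norm_sq]
    exact (hKρ huse i).trans (hle (le_max_left _ _))
  · refine le_trans ?_ (hle (le_max_right _ _))
    rw [Finset.sum_mul]
    refine Finset.sum_le_sum fun j _ => ?_
    rw [frobSq_eq_norm_sq]
    exact hKP j i

/-- There are finitely many choices, so the constant can be made independent of the one taken. -/
theorem StateChoice.exists_upper_bound (f : StateChoice M → ℝ) : ∃ K, 0 ≤ K ∧ ∀ ch, f ch ≤ K := by
  refine ⟨|f .average| + ∑ j, |f (.single j)|, by positivity, fun ch => ?_⟩
  have h0 : 0 ≤ ∑ j, |f (.single j)| := by positivity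
  cases ch with
  | average => linarith [le_abs_self (f .average)]
  | single j =>
    linarith [le_abs_self (f (.single j)), abs_nonneg (f .average), Finset.single_le_sum
      (f := fun j => |f (.single j)|) (fun _ _ => abs_nonneg _) (Finset.mem_univ j)]

end Deterministic

end SimulTomo

/-! ### Expectations over the records and the final constants -/

theorem theorem3 {d L M : ℕ}
    (A : Fin L → Fin (d ^ 2) → Matrix (Fin d) (Fin d) ℂ)
    (hA : ∀ a, SimulTomo.IsProcess (A a))
    (ρ₀ : Matrix (Fin d) (Fin d) ℂ) (hρ₀ : SimulTomo.IsDensity ρ₀)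
    (P : Fin M → Matrix (Fin d) (Fin d) ℂ) (hP : SimulTomo.IsPOVM P) :
    -- orthonormal-basis algorithm
    (∀ (Ω : Fin (d ^ 2 - 1) → Matrix (Fin d) (Fin d) ℂ) (hΩ : SimulTomo.IsTracelessBasis Ω)
        (k₀ : Fin (d ^ 2 - 1)),
      (∀ a, SimulTomo.IsGeneralizedUnital (A a)) →
      (SimulTomo.designB Ω A).rank = (d ^ 2 - 1) ^ 2 →
      SimulTomo.coeff Ω ρ₀ k₀ ≠ 0 →
      ∃ K : ℝ, ∀ N₀ : ℕ, 0 < N₀ →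
        ∀ (ch : SimulTomo.StateChoice M)
          (ρh : SimulTomo.FullRecord A M N₀ → Matrix (Fin d) (Fin d) ℂ)
          (Ph : SimulTomo.FullRecord A M N₀ → Fin M → Matrix (Fin d) (Fin d) ℂ),
          (∀ r, SimulTomo.IsOrthonormalOutput hΩ k₀ A ch r (ρh r) (Ph r)) →
          ((∀ j, ch.Uses j → ∃ k, SimulTomo.coeff Ω (P j) k ≠ 0) →
            SimulTomo.fullExpectation A ρ₀ P (hΩ.herm k₀)
              (fun r => SimulTomo.frobSq (ρh r - ρ₀)) ≤ K / SimulTomo.fullCopies A N₀) ∧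
          SimulTomo.fullExpectation A ρ₀ P (hΩ.herm k₀)
            (fun r => ∑ j, SimulTomo.frobSq (Ph r j - P j)) ≤ K / SimulTomo.fullCopies A N₀) ∧
    -- natural-basis algorithm
    ((SimulTomo.designNatural A).rank = d ^ 4 →
      ∃ K : ℝ, ∀ N₀ : ℕ, 0 < N₀ →
        ∀ (ch : SimulTomo.StateChoice M)
          (ρh : SimulTomo.OutputRecord L M N₀ → Matrix (Fin d) (Fin d) ℂ)
          (Ph : SimulTomo.OutputRecord L M N₀ → Fin M → Matrix (Fin d) (Fin d) ℂ),
          (∀ r, SimulTomo.IsNaturalOutput A ch r (ρh r) (Ph r)) →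
          ((∀ j, ch.Uses j → P j ≠ 0) →
            SimulTomo.outputExpectation A ρ₀ P
              (fun r => SimulTomo.frobSq (ρh r - ρ₀)) ≤ K / ((L * N₀ : ℕ) : ℝ)) ∧
          SimulTomo.outputExpectation A ρ₀ P
            (fun r => ∑ j, SimulTomo.frobSq (Ph r j - P j)) ≤ K / ((L * N₀ : ℕ) : ℝ)) := by
  have hd := hρ₀.dim_ne_zero
  refine ⟨fun Ω hΩ k₀ hgu hrank hk₀ => ?_, fun hrank => ?_⟩
  · choose f hf using SimulTomo.exists_orthonormal_bound hρ₀ hP hΩ k₀ hgu hrank hk₀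
    obtain ⟨K, hK0, hK⟩ := SimulTomo.StateChoice.exists_upper_bound f
    obtain ⟨C, -, hC⟩ :=
      SimulTomo.exists_fullExpectation_fullError_le (hΩ.herm k₀) hd hA hρ₀ hP
    -- The number of copies at `N₀ = 1` is `L + L' + 2`, the fixed ratio that turns a bound in `1 /
    -- N₀` into one in `1 / N`.
    refine ⟨K * C * SimulTomo.fullCopies A 1, fun N₀ hN ch ρh Ph hout => ?_⟩
    have hN' : (0 : ℝ) < N₀ := Nat.cast_pos.2 hN
    have hcop : (SimulTomo.fullCopies A N₀ : ℝ) = SimulTomo.fullCopies A 1 * N₀ := by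
      simp [SimulTomo.fullCopies]
    have hcop1 : (0 : ℝ) < SimulTomo.fullCopies A 1 := by
      rw [Nat.cast_pos, SimulTomo.fullCopies]
      positivity
    have hbound : K * SimulTomo.fullExpectation A ρ₀ P (hΩ.herm k₀)
        (SimulTomo.fullError (N₀ := N₀) A ρ₀ P (hΩ.herm k₀)) ≤
        K * C * SimulTomo.fullCopies A 1 / SimulTomo.fullCopies A N₀ := by
      refine (mul_le_mul_of_nonneg_left (hC N₀ hN) hK0).trans_eq ?_
      rw [hcop]
      field_simp
    have hstep : ∀ r, f ch * SimulTomo.fullError A ρ₀ P (hΩ.herm k₀) r ≤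
        K * SimulTomo.fullError (N₀ := N₀) A ρ₀ P (hΩ.herm k₀) r := fun r =>
      mul_le_mul_of_nonneg_right (hK ch) (SimulTomo.fullError_nonneg _ r)
    exact ⟨fun huse => (SimulTomo.fullExpectation_le _ hA hρ₀ hP fun r =>
        ((hf ch N₀ r _ _ (hout r)).1 huse).trans (hstep r)).trans hbound,
      (SimulTomo.fullExpectation_le _ hA hρ₀ hP fun r =>
        (hf ch N₀ r _ _ (hout r)).2.trans (hstep r)).trans hbound⟩
  · choose f hf using SimulTomo.exists_natural_bound hρ₀ hP hrank
    obtain ⟨K, hK0, hK⟩ := SimulTomo.StateChoice.exists_upper_bound f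
    -- The rank `d ^ 4` is at most the number `L` of rows, so the quotient by `L * N₀` is a genuine
    -- one.
    have hL : 0 < L := by
      have h1 : d ^ 4 ≤ L := by
        simpa [hrank] using Matrix.rank_le_card_height (SimulTomo.designNatural A)
      exact lt_of_lt_of_le (by positivity) h1
    refine ⟨K * (L * M) * L, fun N₀ hN ch ρh Ph hout => ?_⟩
    have hN' : (0 : ℝ) < N₀ := Nat.cast_pos.2 hN
    have hL' : (0 : ℝ) < L := Nat.cast_pos.2 hL
    have hbound : K * SimulTomo.outputExpectation A ρ₀ P
        (SimulTomo.outputError (N₀ := N₀) A ρ₀ P) ≤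
        K * (L * M) * L / ((L * N₀ : ℕ) : ℝ) := by
      refine (mul_le_mul_of_nonneg_left
        (SimulTomo.outputExpectation_outputError_le hN hA hρ₀ hP) hK0).trans_eq ?_
      push_cast
      field_simp
    have hstep : ∀ r, f ch * SimulTomo.outputError A ρ₀ P r ≤
        K * SimulTomo.outputError (N₀ := N₀) A ρ₀ P r := fun r =>
      mul_le_mul_of_nonneg_right (hK ch) (SimulTomo.outputError_nonneg r)
    exact ⟨fun huse => (SimulTomo.outputExpectation_le hA hρ₀ hP fun r =>
        ((hf ch N₀ r _ _ (hout r)).1 huse).trans (hstep r)).trans hbound,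
      (SimulTomo.outputExpectation_le hA hρ₀ hP fun r =>
        (hf ch N₀ r _ _ (hout r)).2.trans (hstep r)).trans hbound⟩
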